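/- Let $\mathcal H_2=\{(x,y,z)\in\mathbb R^3 : z^2-x^2-y^2=1,\ z>0\}$ be the hyperboloid model of the hyperbolic plane, with $\langle X,Y\rangle_{\mathcal H}=x_1x_2+y_1y_2-z_1z_2$ and $X\times_{\mathcal H}Y=(y_1z_2-z_1y_2,\ z_1x_2-x_1z_2,\ -x_1y_2+y_1x_2)$ for $X=(x_1,y_1,z_1)$, $Y=(x_2,y_2,z_2)$, and with distance $d$ given by $\langle X,Y\rangle_{\mathcal H}=-\cosh d(X,Y)$. Let $\Gamma_1,\Gamma_2,\Gamma_3$ be nonzero real vorticities and let $\mathcal M$ be the space of triples $X=(X_1,X_2,X_3)$ of pairwise distinct points of $\mathcal H_2$, with the point vortex dynamics $$\dot X_r=\frac1\pi\sum_{p\ne r}\Gamma_p\,\frac{X_p\times_{\mathcal H}X_r}{\langle X_r,X_p\rangle_{\mathcal H}^2-1}.$$ Identify $v=(x,y,z)\in\mathbb R^3$ with the traceless matrix $\begin{pmatrix}x&y+z\\ y-z&-x\end{pmatrix}$, and so (through the pairing $\langle\mu,\xi\rangle=\frac12\operatorname{tr}(\xi\mu)$) with an element of $\mathfrak{sl}(2,\mathbb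 R)^*$. The group $\mathsf{SL}(2,\mathbb R)$ acts on $\mathbb R^3$ by $\mu\mapsto g\mu g^{-1}$ in terms of these matrices; this preserves $\mathcal H_2$, and the group acts diagonally on $\mathcal M$. The momentum map is $\mathbf J(X)=\Gamma_1X_1+\Gamma_2X_2+\Gamma_3X_3\in\mathfrak{sl}(2,\mathbb R)^*$, and $\mathsf{SL}(2,\mathbb R)_\mu=\{g: g\mu g^{-1}=\mu\}$. One calls $\mu$ hyperbolic (respectively parabolic) if $\mathsf{SL}(2,\mathbb R)_\mu$ is, up to the elements $\pm I$, a one-parameter subgroup whose elements at nonzero times are all hyperbolic (respectively parabolic). A point $X_e\in\mathcal M$ is a relative equilibrium if the trajectory through $X_e$ is contained in the group orbit $\mathsf{SL}(2,\mathbb R)\cdot X_e$; it is equilateral if its three mutual distances are equal. For a subgroup $G'\le\mathsf{SL}(2,\mathbb R)$, a relative equilibrium $X_e$ is $G'$-stable if for every $G'$-invariant neighbourhood $V$ of $X_e$ there is a $G'$-invariant neighbourhood $U$ of $X_e$ such that every trajectory intersecting $U$ lies entirely within $V$; otherwise it is $G'$-unstable. Statement: every equilateral relative equilibrium $X_e\in\mathcal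 M$ whose momentum value $\mu=\mathbf J(X_e)$ is hyperbolic or parabolic is $\mathsf{SL}(2,\mathbb R)$-unstable, and also $\mathsf{SL}(2,\mathbb R)_\mu$-unstable. -/

import Mathlib

open scoped MatrixGroups

noncomputable section

namespace PointVortex

/-- The hyperbolic (Minkowski) inner product `x₁x₂ + y₁y₂ - z₁z₂` on `ℝ³`. -/
def hinner (u v : Fin 3 → ℝ) : ℝ := u 0 * v 0 + u 1 * v 1 - u 2 * v 2

/-- The hyperbolic cross product on `ℝ³`. -/
def hcross (u v : Fin 3 → ℝ) : Fin 3 → ℝ :=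
  ![u 1 * v 2 - u 2 * v 1, u 2 * v 0 - u 0 * v 2, -(u 0 * v 1) + u 1 * v 0]

/-- The hyperboloid model of the hyperbolic plane, with the topology induced from `ℝ³`. -/
abbrev HyperbolicPlane : Type :=
  {X : Fin 3 → ℝ // X 2 ^ 2 - X 0 ^ 2 - X 1 ^ 2 = 1 ∧ 0 < X 2}

/-- The hyperbolic distance, determined by `⟨X, Y⟩ = -cosh (d(X, Y))`. -/
def hdist (X Y : HyperbolicPlane) : ℝ := Real.arcosh (-hinner X.1 Y.1)

/-- The linear map of `ℝ³` by which `g = (a, b; c, d) ∈ SL(2, ℝ)` acts. -/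
def tilde (g : SL(2, ℝ)) : Matrix (Fin 3) (Fin 3) ℝ :=
  let a := g.1 0 0
  let b := g.1 0 1
  let c := g.1 1 0
  let d := g.1 1 1
  (1 / 2 : ℝ) •
    !![2 * (a * d + b * c), -2 * (a * c - b * d), -2 * (a * c + b * d);
       -2 * (a * b - c * d), a ^ 2 - b ^ 2 - c ^ 2 + d ^ 2, a ^ 2 + b ^ 2 - c ^ 2 - d ^ 2;
       -2 * (a * b + c * d), a ^ 2 - b ^ 2 + c ^ 2 - d ^ 2, a ^ 2 + b ^ 2 + c ^ 2 + d ^ 2]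

lemma tilde_mem (g : SL(2, ℝ)) (X : HyperbolicPlane) :
    (tilde g).mulVec X.1 2 ^ 2 - (tilde g).mulVec X.1 0 ^ 2 - (tilde g).mulVec X.1 1 ^ 2 = 1 ∧
      0 < (tilde g).mulVec X.1 2 := by
  obtain ⟨X, hX, hpos⟩ := X
  have hdet : g.1 0 0 * g.1 1 1 - g.1 0 1 * g.1 1 0 = 1 := by
    have := g.2
    rwa [Matrix.det_fin_two] at this
  simp only [tilde, Matrix.mulVec, dotProduct, Fin.sum_univ_three, Matrix.smul_apply, smul_eq_mul]
  simp only [Matrix.of_apply, Matrix.cons_val]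
  generalize g.1 0 0 = a at *
  generalize g.1 0 1 = b at *
  generalize g.1 1 0 = c at *
  generalize g.1 1 1 = d at *
  generalize X 0 = x at *
  generalize X 1 = y at *
  generalize X 2 = z at *
  constructor
  · linear_combination (a * d - b * c) ^ 2 * hX + (a * d - b * c + 1) * hdet
  · have hA : 0 < z + y := by nlinarith [sq_nonneg x]
    have hB : 0 < z - y := by nlinarith [sq_nonneg x]
    set s := (a ^ 2 + c ^ 2) * (z + y) + (b ^ 2 + d ^ 2) * (z - y) with hs
    have hs0 : 0 ≤ s := by positivity
    have hpq : (a ^ 2 + c ^ 2) * (b ^ 2 + d ^ 2) = 1 + (a * b + c * d) ^ 2 := by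
      linear_combination (a * d - b * c + 1) * hdet
    have hAB : (z + y) * (z - y) = 1 + x ^ 2 := by linear_combination hX
    have h1 : 4 * ((1 + (a * b + c * d) ^ 2) * (1 + x ^ 2)) ≤ s ^ 2 := by
      rw [← hpq, ← hAB]
      nlinarith [sq_nonneg ((a ^ 2 + c ^ 2) * (z + y) - (b ^ 2 + d ^ 2) * (z - y))]
    have h2 : |2 * ((a * b + c * d) * x)| < s := by
      apply abs_lt_of_sq_lt_sq _ hs0
      nlinarith [sq_nonneg (a * b + c * d), sq_nonneg x]
    have h3 := (abs_lt.mp h2).2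
    nlinarith [h3, hs]

lemma tilde_one : tilde 1 = 1 := by
  ext i j
  fin_cases i <;> fin_cases j <;> simp [tilde] <;> norm_num

lemma tilde_mul (g h : SL(2, ℝ)) : tilde (g * h) = tilde g * tilde h := by
  ext i j
  fin_cases i <;> fin_cases j <;>
    simp [tilde, Matrix.mul_apply, Fin.sum_univ_succ] <;> ring

/-- The action of `SL(2, ℝ)` on the hyperbolic plane. -/
instance : MulAction SL(2, ℝ) HyperbolicPlane where
  smul g X := ⟨(tilde g).mulVec X.1, tilde_mem g X⟩
  one_smul X := Subtype.ext (by
    change (tilde 1).mulVec X.1 = X.1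
    rw [tilde_one, Matrix.one_mulVec])
  mul_smul g h X := Subtype.ext (by
    change (tilde (g * h)).mulVec X.1 = (tilde g).mulVec ((tilde h).mulVec X.1)
    rw [tilde_mul, Matrix.mulVec_mulVec])

/-- The phase space of `N` point vortices: configurations without collisions. -/
abbrev PhaseSpace (N : ℕ) : Type := {X : Fin N → HyperbolicPlane // Function.Injective X}

/-- The diagonal action of `SL(2, ℝ)` on the phase space. -/
instance (N : ℕ) : MulAction SL(2, ℝ) (PhaseSpace N) where
  smul g X := ⟨fun i => g • X.1 i, (MulAction.injective g).comp X.2⟩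
  one_smul X := Subtype.ext (funext fun i => one_smul _ (X.1 i))
  mul_smul g h X := Subtype.ext (funext fun i => mul_smul g h (X.1 i))

/-- The velocity of the `r`-th vortex in the configuration `X` with vorticities `Γ`. -/
def velocity {N : ℕ} (Γ : Fin N → ℝ) (X : PhaseSpace N) (r : Fin N) : Fin 3 → ℝ :=
  (1 / Real.pi) • ∑ p ∈ Finset.univ.erase r,
    (Γ p / (hinner (X.1 r).1 (X.1 p).1 ^ 2 - 1)) • hcross (X.1 p).1 (X.1 r).1

/-- `γ` is, on the open interval `I`, a trajectory of the point vortex system. -/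
def IsTrajectory {N : ℕ} (Γ : Fin N → ℝ) (I : Set ℝ) (γ : ℝ → PhaseSpace N) : Prop :=
  IsOpen I ∧ I.OrdConnected ∧
    ∀ t ∈ I, ∀ r, HasDerivAt (fun s => ((γ s).1 r).1) (velocity Γ (γ t) r) t

/-- A relative equilibrium: every trajectory through `X` stays in the group orbit of `X`. -/
def IsRelativeEquilibrium {N : ℕ} (Γ : Fin N → ℝ) (X : PhaseSpace N) : Prop :=
  ∀ (I : Set ℝ) (γ : ℝ → PhaseSpace N), IsTrajectory Γ I γ → ∀ t₀ ∈ I, γ t₀ = X →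
    ∀ t ∈ I, γ t ∈ MulAction.orbit SL(2, ℝ) X

/-- Equilateral configurations: all the mutual hyperbolic distances are equal. -/
def IsEquilateral {N : ℕ} (X : PhaseSpace N) : Prop :=
  ∀ i j k l : Fin N, i ≠ j → k ≠ l → hdist (X.1 i) (X.1 j) = hdist (X.1 k) (X.1 l)

/-- The identification of `ℝ³` with the traceless `2 × 2` matrices, and thus, through the pairing
`⟨μ, ξ⟩ = tr (ξ μ) / 2`, with the dual of the Lie algebra of `SL(2, ℝ)`. -/
def toMatrix (v : Fin 3 → ℝ) : Matrix (Fin 2) (Fin 2) ℝ :=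
  !![v 0, v 1 + v 2; v 1 - v 2, -v 0]

/-- The momentum map `∑ Γᵢ Xᵢ`, with values in the dual of the Lie algebra of `SL(2, ℝ)`. -/
def momentum {N : ℕ} (Γ : Fin N → ℝ) (X : PhaseSpace N) : Matrix (Fin 2) (Fin 2) ℝ :=
  toMatrix (∑ i, Γ i • (X.1 i).1)

/-- The coadjoint action `μ ↦ g μ g⁻¹`. -/
def coadjoint (g : SL(2, ℝ)) (μ : Matrix (Fin 2) (Fin 2) ℝ) : Matrix (Fin 2) (Fin 2) ℝ :=
  (g : Matrix (Fin 2) (Fin 2) ℝ) * μ * ((g⁻¹ : SL(2, ℝ)) : Matrix (Fin 2) (Fin 2) ℝ)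

/-- The coadjoint isotropy subgroup `SL(2, ℝ)_μ`. -/
def isotropy (μ : Matrix (Fin 2) (Fin 2) ℝ) : Subgroup SL(2, ℝ) where
  carrier := {g | coadjoint g μ = μ}
  one_mem' := by simp [coadjoint]
  mul_mem' := by
    intro g h hg hh
    have hg' : coadjoint g μ = μ := hg
    have hh' : coadjoint h μ = μ := hh
    have key : coadjoint (g * h) μ = coadjoint g (coadjoint h μ) := by
      simp only [coadjoint, mul_inv_rev, Matrix.SpecialLinearGroup.coe_mul, Matrix.mul_assoc]
    change coadjoint (g * h) μ = μ
    rw [key, hh', hg']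
  inv_mem' := by
    intro g hg
    have hg' : coadjoint g μ = μ := hg
    change coadjoint g⁻¹ μ = μ
    have key : coadjoint g⁻¹ (coadjoint g μ) = μ := by
      simp only [coadjoint, inv_inv, ← Matrix.mul_assoc, ← Matrix.SpecialLinearGroup.coe_mul,
        inv_mul_cancel, Matrix.SpecialLinearGroup.coe_one, one_mul]
      rw [Matrix.mul_assoc, ← Matrix.SpecialLinearGroup.coe_mul, inv_mul_cancel]
      simp
    rwa [hg'] at key

/-- Up to the elements `±1`, which act trivially, the group `H` is a one-parameter subgroup of
`SL(2, ℝ)` all of whose elements, except at time zero, have the property `P`. -/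
def IsOneParameterOfType (P : Matrix (Fin 2) (Fin 2) ℝ → Prop) (H : Subgroup SL(2, ℝ)) : Prop :=
  ∃ φ : Multiplicative ℝ →* SL(2, ℝ), Continuous φ ∧
    (∀ g, g ∈ H ↔ ∃ t, g = φ t ∨ g = -φ t) ∧
    ∀ t, t ≠ 1 → P (φ t : Matrix (Fin 2) (Fin 2) ℝ)

/-- `μ` is hyperbolic: `SL(2, ℝ)_μ` is generated by a hyperbolic Möbius transformation. -/
def IsHyperbolicMomentum (μ : Matrix (Fin 2) (Fin 2) ℝ) : Prop :=
  IsOneParameterOfType Matrix.IsHyperbolic (isotropy μ)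

/-- `μ` is parabolic: `SL(2, ℝ)_μ` is generated by a parabolic Möbius transformation. -/
def IsParabolicMomentum (μ : Matrix (Fin 2) (Fin 2) ℝ) : Prop :=
  IsOneParameterOfType Matrix.IsParabolic (isotropy μ)

/-- Invariance of a set of configurations under a subgroup of `SL(2, ℝ)`. -/
def IsInvariant {N : ℕ} (H : Subgroup SL(2, ℝ)) (V : Set (PhaseSpace N)) : Prop :=
  ∀ g ∈ H, ∀ Y ∈ V, g • Y ∈ V

/-- Stability of `X` relative to the subgroup `H`: for every `H`-invariant neighbourhood `V` of `X`
there is an `H`-invariant neighbourhood `U` of `X` such that every trajectory intersecting `U` lies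
entirely within `V`. -/
def IsStable {N : ℕ} (Γ : Fin N → ℝ) (H : Subgroup SL(2, ℝ)) (X : PhaseSpace N) : Prop :=
  ∀ V : Set (PhaseSpace N), IsOpen V → X ∈ V → IsInvariant H V →
    ∃ U : Set (PhaseSpace N), IsOpen U ∧ X ∈ U ∧ IsInvariant H U ∧
      ∀ (I : Set ℝ) (γ : ℝ → PhaseSpace N), IsTrajectory Γ I γ →
        (∃ t₀ ∈ I, γ t₀ ∈ U) → ∀ t ∈ I, γ t ∈ V

end PointVortex

end

/-!
The mutual distances of the vortices satisfy a closed system of equations. Let `u` be the vector of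
the hyperbolic cosines of the sides of the triangle `X`, each side indexed by the opposite vertex,
let `D` be the triple product of the vertices and `f(u) = 1 / (u² - 1)`. Then, up to the factor
`1 / π`, `u' = D • A (f ∘ u)`, where `A y = (Γ₀ (y₁ - y₂), Γ₁ (y₂ - y₀), Γ₂ (y₀ - y₁))`
(`hasDerivAt_coshSide`). The sum `∑ uᵢ / Γᵢ` is conserved, and `D ≠ 0` near an equilateral triangle.

At an equilateral triangle with sides `arcosh a` and momentum vector `v` one finds
`⟨v, v⟩ = -(∑ Γᵢ)² - 2 (a - 1) σ` with `σ = Γ₀ Γ₁ + Γ₁ Γ₂ + Γ₂ Γ₀`. If the momentum is hyperbolic or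
parabolic, then `v` is not timelike, since the isotropy group of a timelike vector contains elliptic
elements. As the vorticities do not vanish, this gives `σ < 0` (`vorticity_sum_neg`).

On the plane `∑ δᵢ / Γᵢ = 0` of perturbations that preserve the conserved sum, `A² = -σ`, so the
linearization `δ' = D f'(a) A δ` is a saddle. No eigenvectors are needed to see the instability: for
a positive diagonal inner product, the function `W = ⟨δ, A δ⟩` has, along the reduced equations, the
derivative `D f'(a) (⟨A δ, A δ⟩ - σ ⟨δ, δ⟩)` up to terms of higher order (`exists_chetaevDeriv_le`).
Hence `W'` has a fixed sign and `|W'| ≥ κ |W|`, and a trajectory with `W ≠ 0` at time zero leaves a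
fixed neighbourhood of the equilateral triangle, in the future or in the past
(`exists_le_abs_of_mul_abs_le_deriv`). Stability concerns whole trajectories, so either direction
of time contradicts it. Suitable initial configurations exist arbitrarily close to `X`
(`exists_coshSide_perturbation`).

The neighbourhood is defined by the sides of the triangle, hence invariant under `SL(2, ℝ)`, and
nothing is assumed of the initial configurations except that they are close to `X`. So the argument
applies to stability with respect to any subgroup (`not_isStable_of_vorticity_sum_neg`).

Trajectories that exist long enough come from a regularized vector field whose velocities are
bounded in the hyperbolic metric (`exists_vortexField_solution`).
-/

noncomputable section

namespace PointVortex

/-! ### The geometry of triangles in the hyperboloid model -/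

lemma hinner_comm (u v : Fin 3 → ℝ) : hinner u v = hinner v u := by
  simp only [hinner]; ring

/-- The position vectors of the three vortices of a configuration. -/
def position (X : PhaseSpace 3) : Fin 3 → Fin 3 → ℝ := fun i => (X.1 i).1

/-- The hyperbolic cosines of the sides of a triangle in `ℝ³`, each side indexed by the opposite
vertex. -/
def coshSide (x : Fin 3 → Fin 3 → ℝ) : Fin 3 → ℝ :=
  ![-hinner (x 1) (x 2), -hinner (x 0) (x 2), -hinner (x 0) (x 1)]

/-- The triple product `⟨x₀ × x₁, x₂⟩` of the vertices of a triangle in `ℝ³`. -/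
def tripleProduct (x : Fin 3 → Fin 3 → ℝ) : ℝ := hinner (hcross (x 0) (x 1)) (x 2)

/-- The points of the hyperboloid, as a predicate on `ℝ³`. -/
def OnHyperboloid (v : Fin 3 → ℝ) : Prop := v 2 ^ 2 - v 0 ^ 2 - v 1 ^ 2 = 1 ∧ 0 < v 2

lemma one_lt_neg_hinner {u v : Fin 3 → ℝ} (hu : OnHyperboloid u) (hv : OnHyperboloid v)
    (huv : u ≠ v) : 1 < -hinner u v := by
  obtain ⟨hu, hu0⟩ := hu
  obtain ⟨hv, hv0⟩ := hv
  by_contra! h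
  apply huv
  simp only [hinner] at h
  -- `(u₂v₂)² = (1 + |a|²)(1 + |b|²) = (1 + a·b)² + |a - b|² + (a ∧ b)²` for the horizontal
  -- components `a`, `b` of `u`, `v`.
  have key : (u 2 * v 2) ^ 2 = (1 + u 0 * v 0 + u 1 * v 1) ^ 2 + (u 0 - v 0) ^ 2
      + (u 1 - v 1) ^ 2 + (u 0 * v 1 - u 1 * v 0) ^ 2 := by
    linear_combination (v 2) ^ 2 * hu + (1 + u 0 ^ 2 + u 1 ^ 2) * hv
  have hle : (u 2 * v 2) ^ 2 ≤ (1 + u 0 * v 0 + u 1 * v 1) ^ 2 := by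
    have : 0 < u 2 * v 2 := mul_pos hu0 hv0
    apply pow_le_pow_left₀ this.le
    linarith
  have h0 : u 0 = v 0 := by
    nlinarith [sq_nonneg (u 0 - v 0), sq_nonneg (u 1 - v 1), sq_nonneg (u 0 * v 1 - u 1 * v 0)]
  have h1 : u 1 = v 1 := by
    nlinarith [sq_nonneg (u 0 - v 0), sq_nonneg (u 1 - v 1), sq_nonneg (u 0 * v 1 - u 1 * v 0)]
  have h2 : u 2 = v 2 := by
    rw [← pow_left_inj₀ hu0.le hv0.le two_ne_zero]
    rw [h0, h1] at hu
    linarith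
  ext i
  fin_cases i <;> assumption

lemma ne_of_hinner_ne {u v : Fin 3 → ℝ} (hu : OnHyperboloid u) (h : hinner u v ≠ -1) :
    u ≠ v := by
  rintro rfl
  apply h
  simp only [hinner]
  linarith [hu.1]

/-- The Gram determinant of three points of the hyperboloid. -/
lemma tripleProduct_sq {x : Fin 3 → Fin 3 → ℝ} (hx : ∀ r, OnHyperboloid (x r)) :
    tripleProduct x ^ 2 = 1 + 2 * coshSide x 0 * coshSide x 1 * coshSide x 2
      - coshSide x 0 ^ 2 - coshSide x 1 ^ 2 - coshSide x 2 ^ 2 := by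
  have h0 : hinner (x 0) (x 0) = -1 := by simp only [hinner]; linarith [(hx 0).1]
  have h1 : hinner (x 1) (x 1) = -1 := by simp only [hinner]; linarith [(hx 1).1]
  have h2 : hinner (x 2) (x 2) = -1 := by simp only [hinner]; linarith [(hx 2).1]
  -- minus the determinant of the Gram matrix, before the diagonal entries are evaluated
  have key : tripleProduct x ^ 2 =
      -(hinner (x 0) (x 0) * hinner (x 1) (x 1) * hinner (x 2) (x 2)
        + 2 * hinner (x 0) (x 1) * hinner (x 1) (x 2) * hinner (x 0) (x 2)
        - hinner (x 0) (x 0) * hinner (x 1) (x 2) ^ 2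
        - hinner (x 1) (x 1) * hinner (x 0) (x 2) ^ 2
        - hinner (x 2) (x 2) * hinner (x 0) (x 1) ^ 2) := by
    simp [tripleProduct, hinner, hcross]
    ring
  rw [key, h0, h1, h2]
  simp [coshSide]
  ring

/-- The height of `u × v` is at most `sinh (d(u, v))` times the height of `v`. -/
lemma hcross_two_sq_le {u v : Fin 3 → ℝ} (hu : OnHyperboloid u) (hv : OnHyperboloid v) :
    hcross u v 2 ^ 2 ≤ (hinner u v ^ 2 - 1) * v 2 ^ 2 := by
  have key : hcross u v 2 ^ 2 = (hinner u v ^ 2 - 1) * (v 2 ^ 2 - 1)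
      - (u 2 + hinner u v * v 2) ^ 2 := by
    have hu' := hu.1
    have hv' := hv.1
    have e1 : hcross u v 2 ^ 2 = (u 0 ^ 2 + u 1 ^ 2) * (v 0 ^ 2 + v 1 ^ 2)
        - (hinner u v + u 2 * v 2) ^ 2 := by
      simp [hcross, hinner]; ring
    rw [e1, show u 0 ^ 2 + u 1 ^ 2 = u 2 ^ 2 - 1 by linarith,
      show v 0 ^ 2 + v 1 ^ 2 = v 2 ^ 2 - 1 by linarith]
    ring
  have h1 : 1 ≤ hinner u v ^ 2 := by
    by_cases h : u = v
    · subst h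
      have : hinner u u = -1 := by simp only [hinner]; linarith [hu.1]
      rw [this]; norm_num
    · nlinarith [one_lt_neg_hinner hu hv h]
  nlinarith [sq_nonneg (u 2 + hinner u v * v 2)]

/-- Vectors tangent to the hyperboloid are spacelike. -/
lemma hinner_self_pos_of_tangent {u d : Fin 3 → ℝ} (hu : OnHyperboloid u) (hd : d ≠ 0)
    (h : hinner d u = 0) : 0 < hinner d d := by
  obtain ⟨hu, hu0⟩ := hu
  have hne : 0 < d 0 ^ 2 + d 1 ^ 2 := by
    by_contra! hle
    have h0 : d 0 = 0 := by nlinarith [sq_nonneg (d 0), sq_nonneg (d 1)]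
    have h1 : d 1 = 0 := by nlinarith [sq_nonneg (d 0), sq_nonneg (d 1)]
    have h2 : d 2 = 0 := by
      simp only [hinner, h0, h1] at h
      simpa [hu0.ne'] using h
    apply hd
    ext i
    fin_cases i <;> assumption
  simp only [hinner] at h ⊢
  have h2 : (d 2 * u 2) ^ 2 = (d 0 * u 0 + d 1 * u 1) ^ 2 := by
    rw [show d 2 * u 2 = d 0 * u 0 + d 1 * u 1 by linarith]
  have key : (d 0 * d 0 + d 1 * d 1 - d 2 * d 2) * u 2 ^ 2
      = d 0 ^ 2 + d 1 ^ 2 + (d 0 * u 1 - d 1 * u 0) ^ 2 := by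
    linear_combination (d 0 ^ 2 + d 1 ^ 2) * hu - h2
  have : 0 < (d 0 * d 0 + d 1 * d 1 - d 2 * d 2) * u 2 ^ 2 := by
    rw [key]; positivity
  exact pos_of_mul_pos_left this (by positivity)

lemma hinner_tilde (g : SL(2, ℝ)) (u v : Fin 3 → ℝ) :
    hinner ((tilde g).mulVec u) ((tilde g).mulVec v) = hinner u v := by
  have hdet : g.1 0 0 * g.1 1 1 - g.1 0 1 * g.1 1 0 = 1 := by
    have := g.2
    rwa [Matrix.det_fin_two] at this
  simp only [hinner, tilde, Matrix.mulVec, dotProduct, Fin.sum_univ_three, Matrix.smul_apply,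
    smul_eq_mul]
  simp only [Matrix.of_apply, Matrix.cons_val]
  generalize g.1 0 0 = a at *
  generalize g.1 0 1 = b at *
  generalize g.1 1 0 = c at *
  generalize g.1 1 1 = d at *
  linear_combination (u 0 * v 0 + u 1 * v 1 - u 2 * v 2) * (a * d - b * c + 1) * hdet

lemma coshSide_position_smul (g : SL(2, ℝ)) (X : PhaseSpace 3) :
    coshSide (position (g • X)) = coshSide (position X) := by
  have h : ∀ i, position (g • X) i = (tilde g).mulVec (position X i) := fun _ => rfl
  simp only [coshSide, h, hinner_tilde]

lemma onHyperboloid_position (X : PhaseSpace 3) (r : Fin 3) : OnHyperboloid (position X r) :=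
  (X.1 r).2

lemma position_ne (X : PhaseSpace 3) {r s : Fin 3} (h : r ≠ s) : position X r ≠ position X s :=
  fun he => h (X.2 (Subtype.ext he))

lemma isInducing_position : Topology.IsInducing position :=
  (Topology.IsInducing.piMap fun _ : Fin 3 => Topology.IsInducing.subtypeVal).comp
    Topology.IsInducing.subtypeVal

lemma position_injective : Function.Injective position := fun _ _ h =>
  Subtype.ext (funext fun r => Subtype.ext (congrFun h r))

lemma exists_position_eq {x : Fin 3 → Fin 3 → ℝ} (hx : ∀ r, OnHyperboloid (x r))
    (hu : ∀ i, 1 < coshSide x i) : ∃ Y : PhaseSpace 3, position Y = x := by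
  have h01 : x 0 ≠ x 1 := ne_of_hinner_ne (hx 0) fun h => by
    have := hu 2; simp [coshSide, h] at this
  have h02 : x 0 ≠ x 2 := ne_of_hinner_ne (hx 0) fun h => by
    have := hu 1; simp [coshSide, h] at this
  have h12 : x 1 ≠ x 2 := ne_of_hinner_ne (hx 1) fun h => by
    have := hu 0; simp [coshSide, h] at this
  refine ⟨⟨fun r => ⟨x r, hx r⟩, fun r s hrs => ?_⟩, rfl⟩
  replace hrs : x r = x s := congrArg Subtype.val hrs
  fin_cases r <;> fin_cases s <;> first | rfl | exact absurd hrs ‹_› | exact absurd hrs.symm ‹_›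

lemma continuous_coshSide : Continuous coshSide := by
  refine continuous_pi fun i => ?_
  fin_cases i <;> simp [coshSide, hinner] <;> fun_prop

lemma continuous_tripleProduct : Continuous tripleProduct := by
  unfold tripleProduct
  simp [hinner, hcross]
  fun_prop

lemma IsEquilateral.exists_coshSide_eq {X : PhaseSpace 3} (hX : IsEquilateral X) :
    ∃ a : ℝ, 1 < a ∧ ∀ i, coshSide (position X) i = a := by
  have hlt : ∀ r s : Fin 3, r ≠ s → 1 < -hinner (position X r) (position X s) := fun r s h =>
    one_lt_neg_hinner (onHyperboloid_position X r) (onHyperboloid_position X s) (position_ne X h)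
  have heq : ∀ i j k l : Fin 3, i ≠ j → k ≠ l →
      -hinner (position X i) (position X j) = -hinner (position X k) (position X l) :=
    fun i j k l hij hkl => Real.arcosh_injOn (hlt i j hij).le (hlt k l hkl).le (hX i j k l hij hkl)
  refine ⟨_, hlt 1 2 (by decide), fun i => ?_⟩
  fin_cases i
  · rfl
  · exact heq 0 2 1 2 (by decide) (by decide)
  · exact heq 0 1 1 2 (by decide) (by decide)

/-! ### The sign condition on the vorticities -/

/-- If the isotropy group of `v` is hyperbolic or parabolic, then `v` is not timelike: otherwise the
multiple of the matrix of `v` of determinant one would be an elliptic element of the isotropy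
group. -/
lemma hinner_self_nonneg_of_isOneParameterOfType {v : Fin 3 → ℝ}
    {P : Matrix (Fin 2) (Fin 2) ℝ → Prop} (hP : ∀ m, P m → 0 ≤ m.discr)
    (h : IsOneParameterOfType P (isotropy (toMatrix v))) : 0 ≤ hinner v v := by
  by_contra! hneg
  have hdet : (toMatrix v).det = -hinner v v := by
    simp [toMatrix, Matrix.det_fin_two, hinner]; ring
  set q := √(-hinner v v) with hq
  have hq0 : 0 < q := Real.sqrt_pos.mpr (by linarith)
  have hqq : q ^ 2 = -hinner v v := Real.sq_sqrt (by linarith)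
  have hgdet : (q⁻¹ • toMatrix v).det = 1 := by
    rw [Matrix.det_smul, hdet, ← hqq, Fintype.card_fin]
    field_simp
  let g : SL(2, ℝ) := ⟨q⁻¹ • toMatrix v, hgdet⟩
  have hgtr : (g : Matrix (Fin 2) (Fin 2) ℝ).trace = 0 := by
    simp [g, Matrix.trace_fin_two, toMatrix]
  have hg : g ∈ isotropy (toMatrix v) := by
    change coadjoint g (toMatrix v) = toMatrix v
    have hcomm : (g : Matrix (Fin 2) (Fin 2) ℝ) * toMatrix v = toMatrix v * g := by
      simp [g]
    rw [coadjoint, hcomm, Matrix.mul_assoc, ← Matrix.SpecialLinearGroup.coe_mul, mul_inv_cancel,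
      Matrix.SpecialLinearGroup.coe_one, mul_one]
  obtain ⟨φ, -, hφ, hφP⟩ := h
  obtain ⟨t, ht⟩ := (hφ g).mp hg
  have htr : (φ t : Matrix (Fin 2) (Fin 2) ℝ).trace = 0 := by
    rcases ht with ht | ht
    · rw [← ht, hgtr]
    · have : φ t = -g := by rw [ht, neg_neg]
      rw [this, Matrix.SpecialLinearGroup.coe_neg, Matrix.trace_neg, hgtr, neg_zero]
  by_cases h1 : t = 1
  · rw [h1, map_one] at htr
    simp at htr
  · have := hP _ (hφP t h1)
    rw [Matrix.discr_fin_two, htr, (φ t).2] at this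
    norm_num at this

/-- For an equilateral triangle, a momentum that is not timelike forces the second elementary
symmetric function of the vorticities to be negative. -/
lemma vorticity_sum_neg {Γ : Fin 3 → ℝ} (hΓ : ∀ i, Γ i ≠ 0) {X : PhaseSpace 3} {a : ℝ}
    (ha : 1 < a) (hX : ∀ i, coshSide (position X) i = a)
    (hμ : IsHyperbolicMomentum (momentum Γ X) ∨ IsParabolicMomentum (momentum Γ X)) :
    Γ 0 * Γ 1 + Γ 1 * Γ 2 + Γ 2 * Γ 0 < 0 := by
  have hv : 0 ≤ hinner (∑ i, Γ i • (X.1 i).1) (∑ i, Γ i • (X.1 i).1) := by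
    rcases hμ with h | h
    · exact hinner_self_nonneg_of_isOneParameterOfType (fun m hm => hm.le) h
    · exact hinner_self_nonneg_of_isOneParameterOfType (fun m hm => hm.2.ge) h
  have h0 := (onHyperboloid_position X 0).1
  have h1 := (onHyperboloid_position X 1).1
  have h2 := (onHyperboloid_position X 2).1
  have u0 := hX 0
  have u1 := hX 1
  have u2 := hX 2
  have hexp : hinner (∑ i, Γ i • (X.1 i).1) (∑ i, Γ i • (X.1 i).1) =
      -(Γ 0 + Γ 1 + Γ 2) ^ 2 - 2 * (a - 1) * (Γ 0 * Γ 1 + Γ 1 * Γ 2 + Γ 2 * Γ 0) := by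
    simp only [Fin.sum_univ_three, hinner, Pi.add_apply, Pi.smul_apply, smul_eq_mul, coshSide,
      Matrix.cons_val, position] at *
    linear_combination -(Γ 0 ^ 2) * h0 - Γ 1 ^ 2 * h1 - Γ 2 ^ 2 * h2 - 2 * Γ 1 * Γ 2 * u0
      - 2 * Γ 0 * Γ 2 * u1 - 2 * Γ 0 * Γ 1 * u2
  rw [hexp] at hv
  by_contra! hσ
  have := mul_nonneg (sub_pos.mpr ha).le hσ
  have := pow_pos (abs_pos.mpr (hΓ 0)) 2
  rw [sq_abs] at this
  nlinarith [sq_nonneg (Γ 0 + Γ 1 + Γ 2), sq_nonneg (Γ 1), sq_nonneg (Γ 2)]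

/-! ### Perturbing one vertex of a triangle -/

/-- Near an equilateral configuration there are configurations obtained by moving the third vortex
for which the change of the sides is a small nonzero multiple of a prescribed vector. -/
lemma exists_coshSide_perturbation {X : PhaseSpace 3} {a : ℝ} (ha1 : 1 < a)
    (ha : ∀ i, coshSide (position X) i = a) (hD : tripleProduct (position X) ≠ 0)
    (b c : ℝ) (hb : b ≠ 0) {U : Set (PhaseSpace 3)} (hU : IsOpen U) (hXU : X ∈ U) :
    ∃ Y ∈ U, ∃ s : ℝ, s ≠ 0 ∧ coshSide (position Y) 0 = a + s * b ∧
      coshSide (position Y) 1 = a + s * c ∧ coshSide (position Y) 2 = a := by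
  obtain ⟨W, hW, rfl⟩ := isInducing_position.isOpen_iff.mp hU
  set x := position X with hx
  have hH := onHyperboloid_position X
  rw [← hx] at hH
  set D := tripleProduct x with hDdef
  -- `n` is orthogonal to the fixed vertices `x₀`, `x₁`; the vector `d` is tangent to the
  -- hyperboloid at `x₂` and changes the two variable sides at the rates `b` and `c`.
  set n := hcross (x 0) (x 1) with hn
  set d : Fin 3 → ℝ := D⁻¹ • (-c • hcross (x 1) (x 2) - b • hcross (x 2) (x 0)) with hd
  have n0 : hinner n (x 0) = 0 := by simp [hn, hinner, hcross]; ring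
  have n1 : hinner n (x 1) = 0 := by simp [hn, hinner, hcross]; ring
  have n2 : hinner n (x 2) = D := rfl
  have d0 : hinner d (x 0) = -c := by
    have : D * hinner d (x 0) = D * -c := by
      simp only [hd, hinner, Pi.smul_apply, Pi.sub_apply, smul_eq_mul]
      field_simp
      simp [hDdef, tripleProduct, hinner, hcross]; ring
    exact mul_left_cancel₀ hD this
  have d1 : hinner d (x 1) = -b := by
    have : D * hinner d (x 1) = D * -b := by
      simp only [hd, hinner, Pi.smul_apply, Pi.sub_apply, smul_eq_mul]
      field_simp
      simp [hDdef, tripleProduct, hinner, hcross]; ring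
    exact mul_left_cancel₀ hD this
  have d2 : hinner d (x 2) = 0 := by
    simp [hd, hinner, hcross]; ring
  have hdd : 0 < hinner d d := by
    refine hinner_self_pos_of_tangent (hH 2) (fun h => hb ?_) d2
    rw [h] at d1
    simpa [hinner] using d1
  -- The line through `x₂` with direction `e τ` meets the quadric again at `x₂ + s τ • e τ`.
  let e : ℝ → Fin 3 → ℝ := fun τ => d + τ • n
  let q : ℝ → ℝ := fun τ => hinner (e τ) (e τ)
  let s : ℝ → ℝ := fun τ => -2 * τ * D / q τ
  let y : ℝ → Fin 3 → Fin 3 → ℝ := fun τ => ![x 0, x 1, x 2 + s τ • e τ]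
  have he : Continuous e := by fun_prop
  have hqc : Continuous q := by
    simp only [q, hinner]; fun_prop
  have hq0 : 0 < q 0 := by simpa [q, e] using hdd
  have hsc : ContinuousAt s 0 :=
    ContinuousAt.div (by fun_prop) hqc.continuousAt hq0.ne'
  have hyc : ContinuousAt y 0 := by
    refine continuousAt_pi.mpr fun i => ?_
    fin_cases i
    · exact continuousAt_const
    · exact continuousAt_const
    · exact continuousAt_const.add (hsc.smul he.continuousAt)
  have hy0 : y 0 = x := by
    ext i j
    fin_cases i <;> simp [y, s]
  have hW' : ∀ᶠ z in nhds (y 0), z ∈ W ∧ 0 < z 2 2 ∧ ∀ i, 1 < coshSide z i := by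
    rw [hy0]
    have h22 : Continuous fun z : Fin 3 → Fin 3 → ℝ => z 2 2 := by fun_prop
    have hcs : ∀ i, Continuous fun z => coshSide z i := fun i =>
      (continuous_apply i).comp continuous_coshSide
    refine Filter.Eventually.and (hW.mem_nhds hXU)
      ((h22.continuousAt.eventually (lt_mem_nhds (hH 2).2)).and ?_)
    refine Filter.eventually_all.mpr fun i => ?_
    refine (hcs i).continuousAt.eventually (lt_mem_nhds ?_)
    exact ha1.trans_eq (ha i).symm
  have hev := (hyc.eventually hW').and (hqc.continuousAt.eventually (lt_mem_nhds hq0))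
  obtain ⟨τ, ⟨⟨hτW, hτz, hτu⟩, hτq⟩, hτ0⟩ :=
    ((hev.filter_mono nhdsWithin_le_nhds).and
      (eventually_mem_nhdsWithin (a := (0 : ℝ)) (s := {0}ᶜ))).exists
  have hsq : s τ * q τ = -2 * τ * D := div_mul_cancel₀ _ hτq.ne'
  have e0 : hinner (e τ) (x 0) = -c := by
    have : hinner (e τ) (x 0) = hinner d (x 0) + τ * hinner n (x 0) := by simp [e, hinner]; ring
    rw [this, d0, n0]; ring
  have e1 : hinner (e τ) (x 1) = -b := by
    have : hinner (e τ) (x 1) = hinner d (x 1) + τ * hinner n (x 1) := by simp [e, hinner]; ring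
    rw [this, d1, n1]; ring
  have e2 : hinner (e τ) (x 2) = τ * D := by
    have : hinner (e τ) (x 2) = hinner d (x 2) + τ * hinner n (x 2) := by simp [e, hinner]; ring
    rw [this, d2, n2]; ring
  have hyH : ∀ r, OnHyperboloid (y τ r) := by
    intro r
    fin_cases r
    · exact hH 0
    · exact hH 1
    · refine ⟨?_, hτz⟩
      have h2 := (hH 2).1
      have e2' := e2
      have hsq' := hsq
      simp only [q, hinner] at e2' hsq'
      simp only [y, Fin.reduceFinMk, Matrix.cons_val, Pi.add_apply, Pi.smul_apply, smul_eq_mul]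
      linear_combination h2 - 2 * s τ * e2' - s τ * hsq'
  obtain ⟨Y, hY⟩ := exists_position_eq hyH hτu
  refine ⟨Y, ?_, s τ, ?_, ?_, ?_, ?_⟩
  · rw [Set.mem_preimage, hY]; exact hτW
  · have : s τ * q τ ≠ 0 := by
      rw [hsq]
      exact mul_ne_zero (mul_ne_zero (by norm_num) hτ0) hD
    exact left_ne_zero_of_mul this
  · have := ha 0
    rw [hY]
    simp only [coshSide, y, Matrix.cons_val, hinner, Pi.add_apply, Pi.smul_apply,
      smul_eq_mul] at this e1 ⊢
    linear_combination this - s τ * e1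
  · have := ha 1
    rw [hY]
    simp only [coshSide, y, Matrix.cons_val, hinner, Pi.add_apply, Pi.smul_apply,
      smul_eq_mul] at this e0 ⊢
    linear_combination this - s τ * e0
  · rw [hY]; exact ha 2

/-! ### Ordinary differential equations -/

/-- If every solution of the equations obtained from `x' = v x` by slowing it down is confined to
a fixed ball up to time `T`, then the equation has a solution up to time `T`: multiply `v` by a bump
function that is one on this ball, and apply the Picard-Lindelöf theorem to the resulting bounded
Lipschitz field. -/
lemma exists_hasDerivAt_of_confined {E : Type*} [NormedAddCommGroup E] [NormedSpace ℝ E]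
    [FiniteDimensional ℝ E] {v : E → E} (hv : ContDiff ℝ 1 v) (x₀ : E) {T : ℝ} (hT : 0 < T) (R : ℝ)
    (hR : ∀ (ρ : E → ℝ) (α : ℝ → E), (∀ x, 0 ≤ ρ x ∧ ρ x ≤ 1) → α 0 = x₀ →
      (∀ t ∈ Set.Ioo (-T) T, HasDerivAt α (ρ (α t) • v (α t)) t) →
      ∀ t ∈ Set.Ioo (-T) T, ‖α t‖ ≤ R) :
    ∃ α : ℝ → E, α 0 = x₀ ∧ ∀ t ∈ Set.Ioo (-T) T, HasDerivAt α (v (α t)) t := by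
  let χ : ContDiffBump (0 : E) :=
    ⟨max R 1, max R 1 + 1, lt_max_of_lt_right one_pos, lt_add_one _⟩
  have hw : ContDiff ℝ 1 fun x => χ x • v x := χ.contDiff.smul hv
  have hwc : HasCompactSupport fun x => χ x • v x := χ.hasCompactSupport.smul_right
  obtain ⟨K, hK⟩ := hw.lipschitzWith_of_hasCompactSupport hwc one_ne_zero
  obtain ⟨L, hL⟩ := hwc.exists_bound_of_continuous hw.continuous
  have hL0 : 0 ≤ L := (norm_nonneg _).trans (hL 0)
  have hpl : IsPicardLindelof (fun _ x => χ x • v x) (tmin := -T) (tmax := T)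
      ⟨0, by simp [hT.le]⟩ x₀ ⟨L * T, by positivity⟩ 0 ⟨L, hL0⟩ K :=
    IsPicardLindelof.of_time_independent (fun x _ => hL x) hK.lipschitzOnWith (by simp; exact le_rfl)
  obtain ⟨α, hα0, hα⟩ := hpl.exists_eq_forall_mem_Icc_hasDerivWithinAt₀
  have hα' : ∀ t ∈ Set.Ioo (-T) T, HasDerivAt α (χ (α t) • v (α t)) t := fun t ht =>
    (hα t (Set.Ioo_subset_Icc_self ht)).hasDerivAt (Icc_mem_nhds ht.1 ht.2)
  refine ⟨α, hα0, fun t ht => ?_⟩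
  have hone : χ (α t) = 1 := by
    apply χ.one_of_mem_closedBall
    rw [mem_closedBall_zero_iff]
    exact (hR χ α (fun x => ⟨χ.nonneg, χ.le_one⟩) hα0 hα' t ht).trans (le_max_left _ _)
  simpa [hone] using hα' t ht

lemma le_mul_exp_of_abs_deriv_le {z z' : ℝ → ℝ} {K T : ℝ} (hK : 0 ≤ K)
    (hz : ∀ t ∈ Set.Ioo (-T) T, HasDerivAt z (z' t) t) (h : ∀ t ∈ Set.Ioo (-T) T, |z' t| ≤ K * z t) :
    ∀ t ∈ Set.Ioo (-T) T, z t ≤ z 0 * Real.exp (K * T) := by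
  -- the estimate for positive times, to be applied to `z` and to its reflection
  have main : ∀ z z' : ℝ → ℝ, (∀ t ∈ Set.Ioo (-T) T, HasDerivAt z (z' t) t) →
      (∀ t ∈ Set.Ioo (-T) T, |z' t| ≤ K * z t) → ∀ t ∈ Set.Ico 0 T,
      z t ≤ z 0 * Real.exp (K * T) := by
    intro z z' hz h t ht
    have hsub : Set.Icc 0 t ⊆ Set.Ioo (-T) T := fun s hs =>
      ⟨by linarith [hs.1, ht.1, ht.2], by linarith [hs.2, ht.2]⟩
    have hd : ∀ s ∈ Set.Icc 0 t, HasDerivAt (fun s => z s * Real.exp (-K * s))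
        (z' s * Real.exp (-K * s) + z s * (Real.exp (-K * s) * (-K * 1))) s := fun s hs =>
      (hz s (hsub hs)).mul (((hasDerivAt_id s).const_mul (-K)).exp)
    have hanti : AntitoneOn (fun s => z s * Real.exp (-K * s)) (Set.Icc 0 t) := by
      refine antitoneOn_of_deriv_nonpos (convex_Icc 0 t)
        (fun s hs => (hd s hs).continuousAt.continuousWithinAt)
        (fun s hs => (hd s (interior_subset hs)).differentiableAt.differentiableWithinAt)
        fun s hs => ?_
      rw [(hd s (interior_subset hs)).deriv]
      have := (abs_le.mp (h s (hsub (interior_subset hs)))).2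
      have := mul_le_mul_of_nonneg_right this (Real.exp_pos (-K * s)).le
      linarith
    have h0 := hanti (Set.left_mem_Icc.mpr ht.1) (Set.right_mem_Icc.mpr ht.1) ht.1
    have hz0 : 0 ≤ K * z 0 := (abs_nonneg _).trans (h 0 (hsub (Set.left_mem_Icc.mpr ht.1)))
    simp only [mul_zero, Real.exp_zero, mul_one] at h0
    have h1 : z t ≤ z 0 * Real.exp (K * t) := by
      have := mul_le_mul_of_nonneg_right h0 (Real.exp_pos (K * t)).le
      rwa [mul_assoc, ← Real.exp_add, neg_mul, neg_add_cancel, Real.exp_zero, mul_one] at this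
    rcases hK.eq_or_lt with rfl | hK
    · simpa using h1
    · have hz0 : 0 ≤ z 0 := nonneg_of_mul_nonneg_right hz0 hK
      refine h1.trans (mul_le_mul_of_nonneg_left (Real.exp_le_exp.mpr ?_) hz0)
      exact mul_le_mul_of_nonneg_left ht.2.le hK.le
  intro t ht
  rcases le_total 0 t with h0 | h0
  · exact main z z' hz h t ⟨h0, ht.2⟩
  · have := main (fun s => z (-s)) (fun s => -z' (-s))
      (fun s hs => by
        simpa using! (hz (-s) ⟨by linarith [hs.2], by linarith [hs.1]⟩).scomp s (hasDerivAt_neg s))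
      (fun s hs => by
        rw [abs_neg]; exact h (-s) ⟨by linarith [hs.2], by linarith [hs.1]⟩)
      (-t) ⟨by linarith, by linarith [ht.1]⟩
    simpa using this

/-- A function with `g' ≥ κ |g|` becomes large in the future if it is positive at time zero, and in
the past if it is negative. -/
lemma exists_le_abs_of_mul_abs_le_deriv {g g' : ℝ → ℝ} {κ T : ℝ} (hκ : 0 ≤ κ) (hT : 0 ≤ T)
    (hg : ∀ t ∈ Set.Icc (-T) T, HasDerivAt g (g' t) t)
    (h : ∀ t ∈ Set.Icc (-T) T, κ * |g t| ≤ g' t) :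
    ∃ t ∈ Set.Icc (-T) T, κ * |g 0| * T ≤ |g t| := by
  -- positive initial value
  have main : ∀ g g' : ℝ → ℝ, (∀ t ∈ Set.Icc (-T) T, HasDerivAt g (g' t) t) →
      (∀ t ∈ Set.Icc (-T) T, κ * |g t| ≤ g' t) → 0 ≤ g 0 → κ * |g 0| * T ≤ |g T| := by
    intro g g' hg h h0
    have hsub : Set.Icc 0 T ⊆ Set.Icc (-T) T := Set.Icc_subset_Icc_left (by linarith)
    have hcont : ContinuousOn g (Set.Icc 0 T) := fun t ht =>
      (hg t (hsub ht)).continuousAt.continuousWithinAt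
    have hdiff : DifferentiableOn ℝ g (interior (Set.Icc 0 T)) := fun t ht =>
      (hg t (hsub (interior_subset ht))).differentiableAt.differentiableWithinAt
    have hmono : MonotoneOn g (Set.Icc 0 T) := by
      refine monotoneOn_of_deriv_nonneg (convex_Icc 0 T) hcont hdiff fun t ht => ?_
      have ht' := hsub (interior_subset ht)
      rw [(hg t ht').deriv]
      exact (mul_nonneg hκ (abs_nonneg _)).trans (h t ht')
    have hle : κ * |g 0| * (T - 0) ≤ g T - g 0 := by
      refine (convex_Icc 0 T).mul_sub_le_image_sub_of_le_deriv hcont hdiff (fun t ht => ?_)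
        0 (Set.left_mem_Icc.mpr hT) T (Set.right_mem_Icc.mpr hT) hT
      have ht' := hsub (interior_subset ht)
      rw [(hg t ht').deriv]
      refine le_trans (mul_le_mul_of_nonneg_left ?_ hκ) (h t ht')
      have := hmono (Set.left_mem_Icc.mpr hT) (interior_subset ht) (interior_subset ht).1
      rw [abs_of_nonneg h0, abs_of_nonneg (h0.trans this)]
      exact this
    refine le_trans ?_ (le_abs_self _)
    linarith
  rcases le_total 0 (g 0) with h0 | h0
  · exact ⟨T, ⟨by linarith, le_rfl⟩, main g g' hg h h0⟩
  · refine ⟨-T, ⟨le_rfl, by linarith⟩, ?_⟩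
    have hneg : ∀ t ∈ Set.Icc (-T) T, -t ∈ Set.Icc (-T) T := fun t ht =>
      ⟨by linarith [ht.2], by linarith [ht.1]⟩
    have := main (fun t => -g (-t)) (fun t => g' (-t))
      (fun t ht => by
        simpa using! ((hg (-t) (hneg t ht)).scomp t (hasDerivAt_neg t)).neg)
      (fun t ht => by simpa using h (-t) (hneg t ht)) (by simpa using h0)
    simpa using this

/-! ### A Chetaev function for the linearized equations -/

/-- The linear part of the reduced equations `u' = D • interaction Γ (f ∘ u)` satisfied by the
sides `u` of a triangle of vortices. -/
def interaction (Γ y : Fin 3 → ℝ) : Fin 3 → ℝ :=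
  ![Γ 0 * (y 1 - y 2), Γ 1 * (y 2 - y 0), Γ 2 * (y 0 - y 1)]

/-- The pairing `⟨δ, A δ⟩`, where `A = interaction Γ`, for the inner product with weights `n`: up
to scaling, this is the derivative of `⟨δ, δ⟩` along the flow of `δ' = A δ`. -/
def chetaev (n Γ δ : Fin 3 → ℝ) : ℝ := ∑ i, n i * (δ i * interaction Γ δ i)

/-- The derivative `⟨A y, A δ⟩ + ⟨δ, A (A y)⟩` of `chetaev n Γ` at `δ` along `A y`. -/
def chetaevDeriv (n Γ δ y : Fin 3 → ℝ) : ℝ :=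
  ∑ i, n i * (interaction Γ y i * interaction Γ δ i + δ i * interaction Γ (interaction Γ y) i)

/-- On the plane `∑ δᵢ / Γᵢ = 0` the square of `interaction Γ` is multiplication by minus the second
elementary symmetric function of the vorticities. -/
lemma interaction_interaction {Γ δ : Fin 3 → ℝ} (hΓ : ∀ i, Γ i ≠ 0) (hδ : ∑ i, δ i / Γ i = 0)
    (i : Fin 3) : interaction Γ (interaction Γ δ) i =
      -(Γ 0 * Γ 1 + Γ 1 * Γ 2 + Γ 2 * Γ 0) * δ i := by
  have h0 := hΓ 0
  have h1 := hΓ 1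
  have h2 := hΓ 2
  have hS : δ 0 * (Γ 1 * Γ 2) + δ 1 * (Γ 0 * Γ 2) + δ 2 * (Γ 0 * Γ 1) = 0 := by
    rw [Fin.sum_univ_three] at hδ
    field_simp at hδ
    linarith
  fin_cases i <;> simp [interaction] <;> linear_combination hS

lemma chetaevDeriv_self {n Γ δ : Fin 3 → ℝ} (hΓ : ∀ i, Γ i ≠ 0) (hδ : ∑ i, δ i / Γ i = 0) :
    chetaevDeriv n Γ δ δ = ∑ i, n i * interaction Γ δ i ^ 2 +
      -(Γ 0 * Γ 1 + Γ 1 * Γ 2 + Γ 2 * Γ 0) * ∑ i, n i * δ i ^ 2 := by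
  simp only [chetaevDeriv, interaction_interaction hΓ hδ, Fin.sum_univ_three]
  ring

lemma abs_chetaev_le (n Γ : Fin 3 → ℝ) :
    ∃ C, 0 < C ∧ ∀ δ, |chetaev n Γ δ| ≤ C * ∑ i, δ i ^ 2 := by
  refine ⟨∑ i, |n i| * (2 * |Γ i|) + 1, by positivity, fun δ => ?_⟩
  have hle : ∀ i j, |δ i * δ j| ≤ ∑ k, δ k ^ 2 := by
    intro i j
    have hi := Finset.single_le_sum (fun k _ => sq_nonneg (δ k)) (Finset.mem_univ i)
    have hj := Finset.single_le_sum (fun k _ => sq_nonneg (δ k)) (Finset.mem_univ j)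
    rw [abs_le]
    constructor <;> nlinarith [sq_nonneg (δ i + δ j), sq_nonneg (δ i - δ j)]
  have hterm : ∀ i, |δ i * interaction Γ δ i| ≤ 2 * |Γ i| * ∑ k, δ k ^ 2 := by
    have aux : ∀ i j k, |δ i * (Γ i * (δ j - δ k))| ≤ 2 * |Γ i| * ∑ k, δ k ^ 2 := by
      intro i j k
      rw [show δ i * (Γ i * (δ j - δ k)) = Γ i * (δ i * δ j - δ i * δ k) by ring, abs_mul]
      have := (abs_sub (δ i * δ j) (δ i * δ k)).trans (add_le_add (hle i j) (hle i k))
      nlinarith [abs_nonneg (Γ i)]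
    intro i
    fin_cases i
    · exact aux 0 1 2
    · exact aux 1 2 0
    · exact aux 2 0 1
  calc |chetaev n Γ δ| ≤ ∑ i, |n i * (δ i * interaction Γ δ i)| := Finset.abs_sum_le_sum_abs _ _
    _ ≤ ∑ i, |n i| * (2 * |Γ i|) * ∑ k, δ k ^ 2 := by
        refine Finset.sum_le_sum fun i _ => ?_
        rw [abs_mul, mul_assoc]
        exact mul_le_mul_of_nonneg_left (hterm i) (abs_nonneg _)
    _ ≤ _ := by
        rw [← Finset.sum_mul]
        exact mul_le_mul_of_nonneg_right (by linarith) (by positivity)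

lemma abs_chetaevDeriv_le (n Γ : Fin 3 → ℝ) :
    ∃ C, 0 < C ∧ ∀ (δ e : Fin 3 → ℝ) (η : ℝ), (∀ i, |e i| ≤ η * |δ i|) →
      |chetaevDeriv n Γ δ e| ≤ C * η * ∑ i, δ i ^ 2 := by
  -- the coefficients of the bilinear form
  let q : Fin 3 → Fin 3 → ℝ := fun i j => chetaevDeriv n Γ (Pi.single i 1) (Pi.single j 1)
  have hq : ∀ δ e, chetaevDeriv n Γ δ e = ∑ i, ∑ j, q i j * (δ i * e j) := by
    intro δ e
    simp [q, chetaevDeriv, interaction, Fin.sum_univ_three, Pi.single_apply]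
    ring
  refine ⟨∑ i, ∑ j, |q i j| + 1, by positivity, fun δ e η he => ?_⟩
  have hle : ∀ i j, |δ i * e j| ≤ η * ∑ k, δ k ^ 2 := by
    intro i j
    have hi := Finset.single_le_sum (fun k _ => sq_nonneg (δ k)) (Finset.mem_univ i)
    have hj := Finset.single_le_sum (fun k _ => sq_nonneg (δ k)) (Finset.mem_univ j)
    rw [← sq_abs] at hi hj
    rw [abs_mul]
    have h1 : |δ i| * |e j| ≤ |δ i| * (η * |δ j|) := mul_le_mul_of_nonneg_left (he j) (abs_nonneg _)
    have h2 : |δ i| * |δ j| ≤ ∑ k, δ k ^ 2 := by nlinarith [sq_nonneg (|δ i| - |δ j|)]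
    rcases le_or_gt 0 η with hη | hη
    · nlinarith
    · -- a negative `η` forces `δ = 0`
      have h0 : ∀ k, δ k = 0 := fun k => by
        have := (abs_nonneg _).trans (he k)
        have : |δ k| ≤ 0 := by nlinarith
        exact abs_eq_zero.mp (le_antisymm this (abs_nonneg _))
      simp [h0]
  have hN : 0 ≤ η * ∑ k, δ k ^ 2 := (abs_nonneg _).trans (hle 0 0)
  rw [hq, mul_assoc, add_mul, one_mul, Finset.sum_mul]
  refine le_add_of_le_of_nonneg ?_ hN
  refine (Finset.abs_sum_le_sum_abs _ _).trans (Finset.sum_le_sum fun i _ => ?_)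
  rw [Finset.sum_mul]
  refine (Finset.abs_sum_le_sum_abs _ _).trans (Finset.sum_le_sum fun j _ => ?_)
  rw [abs_mul]
  exact mul_le_mul_of_nonneg_left (hle i j) (abs_nonneg _)

/-- Where the linearization of the reduced equations is a saddle, the derivative of the Chetaev
function along the flow is definite near the equilibrium. -/
lemma exists_chetaevDeriv_le {n Γ : Fin 3 → ℝ} (hn : ∀ i, 1 ≤ n i) (hΓ : ∀ i, Γ i ≠ 0)
    (hσ : Γ 0 * Γ 1 + Γ 1 * Γ 2 + Γ 2 * Γ 0 < 0) {f : ℝ → ℝ} {m a : ℝ} (hf : HasDerivAt f m a)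
    (hm : m < 0) :
    ∃ c, 0 < c ∧ ∀ᶠ ε in nhdsWithin (0 : ℝ) (Set.Ioi 0), ∀ u : Fin 3 → ℝ, (∀ i, |u i - a| < ε) →
      ∑ i, (u i - a) / Γ i = 0 →
      chetaevDeriv n Γ (fun i => u i - a) (fun i => f (u i)) ≤ -c * ∑ i, (u i - a) ^ 2 := by
  obtain ⟨C, hC, hCle⟩ := abs_chetaevDeriv_le n Γ
  set σ := Γ 0 * Γ 1 + Γ 1 * Γ 2 + Γ 2 * Γ 0 with hσdef
  have hmσ : 0 < m * σ := mul_pos_of_neg_of_neg hm hσ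
  set η := m * σ / (2 * C) with hη
  have hη0 : 0 < η := by positivity
  refine ⟨m * σ / 2, by positivity, ?_⟩
  have hev : ∀ᶠ s in nhds a, |f s - f a - m * (s - a)| ≤ η * |s - a| := by
    have := (hasDerivAt_iff_isLittleO.mp hf).def hη0
    simpa [mul_comm] using this
  obtain ⟨ε₀, hε₀, hball⟩ := Metric.eventually_nhds_iff.mp hev
  filter_upwards [Ioo_mem_nhdsGT hε₀] with ε hε u hu hS
  set δ : Fin 3 → ℝ := fun i => u i - a with hδ
  let e : Fin 3 → ℝ := fun i => f (u i) - f a - m * (u i - a)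
  have he : ∀ i, |e i| ≤ η * |δ i| := fun i =>
    hball (by rw [Real.dist_eq]; exact (hu i).trans hε.2)
  -- `chetaevDeriv` only depends on the differences of the entries of its last argument
  have hsplit : chetaevDeriv n Γ δ (fun i => f (u i)) =
      m * chetaevDeriv n Γ δ δ + chetaevDeriv n Γ δ e := by
    simp [chetaevDeriv, interaction, Fin.sum_univ_three, e, hδ]
    ring
  have hquad : -σ * ∑ i, δ i ^ 2 ≤ chetaevDeriv n Γ δ δ := by
    rw [chetaevDeriv_self hΓ hS, ← hσdef]
    have h1 : 0 ≤ ∑ i, n i * interaction Γ δ i ^ 2 := Finset.sum_nonneg fun i _ =>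
      mul_nonneg (zero_le_one.trans (hn i)) (sq_nonneg _)
    have h2 : ∑ i, δ i ^ 2 ≤ ∑ i, n i * δ i ^ 2 := Finset.sum_le_sum fun i _ =>
      le_mul_of_one_le_left (sq_nonneg _) (hn i)
    nlinarith
  have herr := (abs_le.mp (hCle δ e η he)).2
  have hCη : C * η = m * σ / 2 := by rw [hη]; field_simp
  rw [hCη] at herr
  rw [hsplit]
  have := mul_le_mul_of_nonpos_left hquad hm.le
  change _ ≤ -(m * σ / 2) * ∑ i, δ i ^ 2
  linarith

/-! ### Trajectories of the regularized equations -/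

/-- A smooth function that agrees with the coupling `1 / (s² - 1)` of the vortex equations near
`-a` and for which the velocities stay bounded in the hyperbolic metric. -/
lemma exists_regular_coupling {a ε : ℝ} (hε : 0 < ε) (ha : 2 * ε < a - 1) :
    ∃ φ : ℝ → ℝ, ContDiff ℝ 1 φ ∧ (∀ s, |s + a| ≤ ε → φ s = (s ^ 2 - 1)⁻¹) ∧
      ∃ K, 0 ≤ K ∧ ∀ s, φ s ^ 2 * (s ^ 2 - 1) ≤ K ^ 2 := by
  let χ : ContDiffBump (-a) := ⟨ε, 2 * ε, hε, by linarith⟩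
  set b := a - 2 * ε with hb
  have hb1 : 1 < b := by linarith
  -- the denominator interpolates between `s ^ 2 - 1` near `-a` and `s ^ 2 + 1`
  let ψ : ℝ → ℝ := fun s => s ^ 2 + 1 - 2 * χ s
  have hin : ∀ s, |s + a| < 2 * ε → b ^ 2 ≤ s ^ 2 := fun s hs => by
    have := (abs_lt.mp hs).2
    nlinarith
  have hout : ∀ s, ¬ |s + a| < 2 * ε → ψ s = s ^ 2 + 1 := fun s hs => by
    have : χ s = 0 := χ.zero_of_le_dist (by
      rw [Real.dist_eq, sub_neg_eq_add]; exact not_lt.mp hs)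
    simp [ψ, this]
  have hle : ∀ s, s ^ 2 - 1 ≤ ψ s := fun s => by
    have := χ.le_one (x := s)
    simp only [ψ]; linarith
  have hpos : ∀ s, 0 < ψ s := fun s => by
    by_cases hs : |s + a| < 2 * ε
    · have := hin s hs
      have := hle s
      nlinarith
    · rw [hout s hs]; positivity
  refine ⟨fun s => (ψ s)⁻¹, ?_, fun s hs => ?_, 1 + (b ^ 2 - 1)⁻¹, ?_, fun s => ?_⟩
  · refine ContDiff.inv ?_ fun s => (hpos s).ne'
    have := χ.contDiff (n := 1)
    fun_prop
  · have : χ s = 1 := χ.one_of_mem_closedBall (by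
      rw [Metric.mem_closedBall, Real.dist_eq, sub_neg_eq_add]; exact hs)
    change (s ^ 2 + 1 - 2 * χ s)⁻¹ = _
    rw [this]
    congr 1; ring
  · have : 0 < b ^ 2 - 1 := by nlinarith
    positivity
  · have hb0 : 0 < b ^ 2 - 1 := by nlinarith
    have hK : 1 ≤ 1 + (b ^ 2 - 1)⁻¹ := by simpa using hb0.le
    have hK2 : (b ^ 2 - 1)⁻¹ ≤ (1 + (b ^ 2 - 1)⁻¹) ^ 2 := by nlinarith
    rw [inv_pow, inv_mul_le_iff₀ (pow_pos (hpos s) 2)]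
    by_cases hs : |s + a| < 2 * ε
    · have h1 := hin s hs
      have h2 := hle s
      calc s ^ 2 - 1 ≤ ψ s ^ 2 * (b ^ 2 - 1)⁻¹ := by
            rw [← div_eq_mul_inv, le_div_iff₀ hb0]
            nlinarith
        _ ≤ _ := mul_le_mul_of_nonneg_left hK2 (sq_nonneg _)
    · have h1 : s ^ 2 - 1 ≤ ψ s ^ 2 * 1 := by
        rw [hout s hs]; nlinarith [sq_nonneg s, sq_nonneg (s ^ 2)]
      refine h1.trans (mul_le_mul_of_nonneg_left ?_ (sq_nonneg _))
      nlinarith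

/-- The vector field of the vortex equations, with vorticities `c` and with an arbitrary
function `φ` of `⟨X_r, X_p⟩` in place of `1 / (⟨X_r, X_p⟩² - 1)`. -/
def vortexField (c : Fin 3 → ℝ) (φ : ℝ → ℝ) (x : Fin 3 → Fin 3 → ℝ) : Fin 3 → Fin 3 → ℝ :=
  fun r => ∑ p ∈ Finset.univ.erase r, (c p * φ (hinner (x r) (x p))) • hcross (x p) (x r)

lemma contDiff_vortexField (c : Fin 3 → ℝ) {φ : ℝ → ℝ} (hφ : ContDiff ℝ 1 φ) :
    ContDiff ℝ 1 (vortexField c φ) := by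
  have hco : ∀ r j, ContDiff ℝ 1 fun x : Fin 3 → Fin 3 → ℝ => x r j := fun r j => by fun_prop
  have hi : ∀ r p, ContDiff ℝ 1 fun x : Fin 3 → Fin 3 → ℝ => hinner (x r) (x p) := fun r p => by
    simp only [hinner]; fun_prop
  have hc : ∀ r p, ContDiff ℝ 1 fun x : Fin 3 → Fin 3 → ℝ => hcross (x p) (x r) := fun r p => by
    refine contDiff_pi.mpr fun j => ?_
    fin_cases j <;> simp [hcross] <;> fun_prop
  refine contDiff_pi.mpr fun r => ?_
  exact ContDiff.sum fun p _ => (contDiff_const.mul (hφ.comp (hi r p))).smul (hc r p)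

lemma hinner_vortexField_self (c : Fin 3 → ℝ) (φ : ℝ → ℝ) (x : Fin 3 → Fin 3 → ℝ) (r : Fin 3) :
    hinner (vortexField c φ x r) (x r) = 0 := by
  have h : ∀ u v, hinner (hcross u v) v = 0 := fun u v => by
    simp [hinner, hcross]; ring
  simp only [vortexField]
  refine Finset.sum_induction _ (fun w => hinner w (x r) = 0) (fun u v hu hv => ?_) ?_ fun p _ => ?_
  · simp only [hinner, Pi.add_apply] at hu hv ⊢
    linear_combination hu + hv
  · simp [hinner]
  · have := h (x p) (x r)
    generalize φ (hinner (x r) (x p)) = y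
    simp only [hinner, Pi.smul_apply, smul_eq_mul] at this ⊢
    linear_combination (c p * y) * this

/-- The third coordinate, which on the hyperboloid bounds the other two, grows at most exponentially
along solutions. -/
lemma abs_vortexField_two_le (c : Fin 3 → ℝ) {φ : ℝ → ℝ} {K : ℝ} (hK : 0 ≤ K)
    (hφ : ∀ s, φ s ^ 2 * (s ^ 2 - 1) ≤ K ^ 2) {x : Fin 3 → Fin 3 → ℝ}
    (hx : ∀ r, OnHyperboloid (x r)) (r : Fin 3) :
    |vortexField c φ x r 2| ≤ (∑ p, |c p|) * K * x r 2 := by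
  have hz := (hx r).2
  have hterm : ∀ p, |φ (hinner (x r) (x p)) * hcross (x p) (x r) 2| ≤ K * x r 2 := fun p => by
    refine abs_le_of_sq_le_sq ?_ (by positivity)
    rw [mul_pow, mul_pow, hinner_comm]
    have h1 := mul_le_mul_of_nonneg_left (hcross_two_sq_le (hx p) (hx r))
      (sq_nonneg (φ (hinner (x p) (x r))))
    have h2 := mul_le_mul_of_nonneg_right (hφ (hinner (x p) (x r))) (sq_nonneg (x r 2))
    linarith
  simp only [vortexField, Finset.sum_apply, Pi.smul_apply, smul_eq_mul]
  rw [mul_assoc, Finset.sum_mul]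
  refine (Finset.abs_sum_le_sum_abs _ _).trans
    ((Finset.sum_le_sum fun p _ => ?_).trans
      (Finset.sum_le_sum_of_subset_of_nonneg (Finset.erase_subset r _) fun p _ _ => by positivity))
  rw [mul_assoc, abs_mul]
  exact mul_le_mul_of_nonneg_left (hterm p) (abs_nonneg _)

lemma pos_of_isPreconnected {S : Set ℝ} (hS : IsPreconnected S) {f : ℝ → ℝ}
    (hf : ContinuousOn f S) (hne : ∀ t ∈ S, f t ≠ 0) {t₀ : ℝ} (ht₀ : t₀ ∈ S) (h0 : 0 < f t₀) :
    ∀ t ∈ S, 0 < f t := by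
  intro t ht
  by_contra! hle
  obtain ⟨s, hs, hs0⟩ := hS.intermediate_value ht ht₀ hf ⟨hle, h0.le⟩
  exact hne s hs hs0

/-- The hyperboloid is invariant under the flow of time-dependent multiples of the vortex
field. -/
lemma onHyperboloid_of_hasDerivAt {c : Fin 3 → ℝ} {φ : ℝ → ℝ} {T : ℝ} {ρ : ℝ → ℝ}
    {α : ℝ → Fin 3 → Fin 3 → ℝ} (h0 : ∀ r, OnHyperboloid (α 0 r))
    (hα : ∀ t ∈ Set.Ioo (-T) T, HasDerivAt α (ρ t • vortexField c φ (α t)) t) :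
    ∀ t ∈ Set.Ioo (-T) T, ∀ r, OnHyperboloid (α t r) := by
  intro t ht r
  have hT : (0 : ℝ) ∈ Set.Ioo (-T) T := ⟨by linarith [ht.1, ht.2], by linarith [ht.1, ht.2]⟩
  have hd : ∀ j, ∀ s ∈ Set.Ioo (-T) T,
      HasDerivAt (fun s => α s r j) (ρ s * vortexField c φ (α s) r j) s := fun j s hs =>
    hasDerivAt_pi.mp (hasDerivAt_pi.mp (hα s hs) r) j
  have hd0 : ∀ s ∈ Set.Ioo (-T) T, HasDerivAt
      (fun s => α s r 2 ^ 2 - α s r 0 ^ 2 - α s r 1 ^ 2) 0 s := fun s hs => by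
    refine ((((hd 2 s hs).pow 2).sub ((hd 0 s hs).pow 2)).sub ((hd 1 s hs).pow 2)).congr_deriv ?_
    have := hinner_vortexField_self c φ (α s) r
    simp only [hinner] at this
    simp only [Nat.cast_ofNat, Nat.add_one_sub_one, pow_one]
    linear_combination (-2 * ρ s) * this
  have hconst : ∀ s ∈ Set.Ioo (-T) T, α s r 2 ^ 2 - α s r 0 ^ 2 - α s r 1 ^ 2 = 1 := fun s hs => by
    rw [← (h0 r).1]
    exact isOpen_Ioo.is_const_of_deriv_eq_zero isPreconnected_Ioo
      (fun s hs => (hd0 s hs).differentiableAt.differentiableWithinAt)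
      (fun s hs => (hd0 s hs).deriv) hs hT
  refine ⟨hconst t ht, pos_of_isPreconnected isPreconnected_Ioo
    (fun s hs => (hd 2 s hs).continuousAt.continuousWithinAt) (fun s hs hz => ?_) hT (h0 r).2 t ht⟩
  have := hconst s hs
  simp only [hz] at this
  nlinarith [sq_nonneg (α s r 0), sq_nonneg (α s r 1)]

lemma exists_vortexField_solution (c : Fin 3 → ℝ) {φ : ℝ → ℝ} (hφ : ContDiff ℝ 1 φ) {K : ℝ}
    (hK : 0 ≤ K) (hφK : ∀ s, φ s ^ 2 * (s ^ 2 - 1) ≤ K ^ 2) {x₀ : Fin 3 → Fin 3 → ℝ}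
    (hx₀ : ∀ r, OnHyperboloid (x₀ r)) {T : ℝ} (hT : 0 < T) :
    ∃ α : ℝ → Fin 3 → Fin 3 → ℝ, α 0 = x₀ ∧ (∀ t ∈ Set.Ioo (-T) T,
      HasDerivAt α (vortexField c φ (α t)) t) ∧
      ∀ t ∈ Set.Ioo (-T) T, ∀ r, OnHyperboloid (α t r) := by
  set L := (∑ p, |c p|) * K
  have hL0 : 0 ≤ L := by positivity
  set R := ∑ r, x₀ r 2 * Real.exp (L * T)
  have hRnn : ∀ r ∈ Finset.univ, 0 ≤ x₀ r 2 * Real.exp (L * T) := fun r _ =>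
    mul_nonneg (hx₀ r).2.le (Real.exp_pos _).le
  obtain ⟨α, hα0, hα⟩ := exists_hasDerivAt_of_confined (contDiff_vortexField c hφ) x₀ hT R
    (fun ρ α hρ hα0 hα t ht => by
      have hH := onHyperboloid_of_hasDerivAt (ρ := fun t => ρ (α t)) (by rwa [hα0]) hα
      refine (pi_norm_le_iff_of_nonneg (Finset.sum_nonneg hRnn)).mpr fun r =>
        (pi_norm_le_iff_of_nonneg (Finset.sum_nonneg hRnn)).mpr fun j => ?_
      have hz : α t r 2 ≤ R := by
        refine le_trans ?_ (Finset.single_le_sum hRnn (Finset.mem_univ r))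
        have := le_mul_exp_of_abs_deriv_le (z := fun s => α s r 2) hL0
          (fun s hs => hasDerivAt_pi.mp (hasDerivAt_pi.mp (hα s hs) r) 2) (fun s hs => ?_) t ht
        · simpa [hα0] using this
        · simp only [Pi.smul_apply, smul_eq_mul, abs_mul]
          rw [abs_of_nonneg (hρ (α s)).1]
          exact (mul_le_of_le_one_left (abs_nonneg _) (hρ (α s)).2).trans
            (abs_vortexField_two_le c hK hφK (hH s hs) r)
      obtain ⟨h1, h2⟩ := hH t ht r
      rw [Real.norm_eq_abs]
      refine le_trans (abs_le_of_sq_le_sq ?_ h2.le) hz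
      fin_cases j <;> simp <;> nlinarith [sq_nonneg (α t r 0), sq_nonneg (α t r 1)])
  refine ⟨α, hα0, hα, onHyperboloid_of_hasDerivAt (c := c) (φ := φ) (ρ := 1)
    (by rwa [hα0]) ?_⟩
  simpa using hα

lemma exists_hinner_eq_neg_coshSide (x : Fin 3 → Fin 3 → ℝ) {r p : Fin 3} (h : r ≠ p) :
    ∃ i, hinner (x r) (x p) = -coshSide x i := by
  have h0 : hinner (x 1) (x 2) = -coshSide x 0 := by simp [coshSide]
  have h1 : hinner (x 0) (x 2) = -coshSide x 1 := by simp [coshSide]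
  have h2 : hinner (x 0) (x 1) = -coshSide x 2 := by simp [coshSide]
  fin_cases r <;> fin_cases p <;>
    first
    | exact absurd rfl h
    | exact ⟨0, h0⟩
    | exact ⟨1, h1⟩
    | exact ⟨2, h2⟩
    | exact ⟨0, (hinner_comm _ _).trans h0⟩
    | exact ⟨1, (hinner_comm _ _).trans h1⟩
    | exact ⟨2, (hinner_comm _ _).trans h2⟩

/-- Solutions of the regularized equations are trajectories of the vortex system as long as the
sides of the triangle are in the region where the coupling has not been changed. -/
lemma exists_isTrajectory {Γ : Fin 3 → ℝ} {φ : ℝ → ℝ} {a ε : ℝ} (hεa : ε < a - 1)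
    (hφ : ∀ s, |s + a| ≤ ε → φ s = (s ^ 2 - 1)⁻¹) (X : PhaseSpace 3)
    {J : Set ℝ} (hJ : IsOpen J) (hJc : J.OrdConnected) {α : ℝ → Fin 3 → Fin 3 → ℝ}
    (hα : ∀ t ∈ J, HasDerivAt α (vortexField (fun p => Γ p / Real.pi) φ (α t)) t)
    (hH : ∀ t ∈ J, ∀ r, OnHyperboloid (α t r))
    (hu : ∀ t ∈ J, ∀ i, |coshSide (α t) i - a| < ε) :
    ∃ γ, IsTrajectory Γ J γ ∧ ∀ t ∈ J, position (γ t) = α t := by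
  have hex : ∀ t, ∃ Y : PhaseSpace 3, t ∈ J → position Y = α t := fun t => by
    by_cases ht : t ∈ J
    · obtain ⟨Y, hY⟩ := exists_position_eq (hH t ht) fun i => by
        have := (abs_lt.mp (hu t ht i)).1
        linarith
      exact ⟨Y, fun _ => hY⟩
    · exact ⟨X, fun h => absurd h ht⟩
  choose γ hγ using hex
  refine ⟨γ, ⟨hJ, hJc, fun t ht r => ?_⟩, hγ⟩
  have hvel : velocity Γ (γ t) r = vortexField (fun p => Γ p / Real.pi) φ (α t) r := by
    rw [← hγ t ht, velocity, vortexField, Finset.smul_sum]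
    refine Finset.sum_congr rfl fun p hp => ?_
    have hne : r ≠ p := (Finset.ne_of_mem_erase hp).symm
    obtain ⟨i, hi⟩ := exists_hinner_eq_neg_coshSide (position (γ t)) hne
    rw [smul_smul, hφ]
    · congr 1
      simp only [position]
      ring
    · rw [hi, hγ t ht, neg_add_eq_sub, abs_sub_comm]
      exact (hu t ht i).le
  rw [hvel]
  refine (hasDerivAt_pi.mp (hα t ht) r).congr_of_eventuallyEq ?_
  filter_upwards [hJ.mem_nhds ht] with s hs
  exact congrFun (hγ s hs) r

/-! ### The reduced equations -/

lemma vortexField_eq (c : Fin 3 → ℝ) (φ : ℝ → ℝ) (x : Fin 3 → Fin 3 → ℝ) :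
    vortexField c φ x =
      let y : Fin 3 → ℝ := fun i => φ (-coshSide x i)
      ![(c 1 * y 2) • hcross (x 1) (x 0) + (c 2 * y 1) • hcross (x 2) (x 0),
        (c 0 * y 2) • hcross (x 0) (x 1) + (c 2 * y 0) • hcross (x 2) (x 1),
        (c 0 * y 1) • hcross (x 0) (x 2) + (c 1 * y 0) • hcross (x 1) (x 2)] := by
  have e0 : (Finset.univ : Finset (Fin 3)).erase 0 = {1, 2} := by decide
  have e1 : (Finset.univ : Finset (Fin 3)).erase 1 = {0, 2} := by decide
  have e2 : (Finset.univ : Finset (Fin 3)).erase 2 = {0, 1} := by decide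
  have c10 := hinner_comm (x 1) (x 0)
  have c20 := hinner_comm (x 2) (x 0)
  have c21 := hinner_comm (x 2) (x 1)
  funext r
  fin_cases r <;> simp [vortexField, e0, e1, e2, c10, c20, c21, coshSide]

/-- The sides of a triangle of vortices satisfy an autonomous system up to a change of time. -/
lemma hasDerivAt_coshSide {c : Fin 3 → ℝ} {φ : ℝ → ℝ} {α : ℝ → Fin 3 → Fin 3 → ℝ} {t : ℝ}
    (hα : HasDerivAt α (vortexField c φ (α t)) t) :
    HasDerivAt (fun s => coshSide (α s))
      (tripleProduct (α t) • interaction c fun i => φ (-coshSide (α t) i)) t := by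
  have hd : ∀ r j, HasDerivAt (fun s => α s r j) (vortexField c φ (α t) r j) t := fun r j =>
    hasDerivAt_pi.mp (hasDerivAt_pi.mp hα r) j
  have hi : ∀ r p, HasDerivAt (fun s => -hinner (α s r) (α s p))
      (-(hinner (vortexField c φ (α t) r) (α t p) + hinner (α t r) (vortexField c φ (α t) p))) t := by
    intro r p
    refine ((((hd r 0).mul (hd p 0)).add ((hd r 1).mul (hd p 1))).sub
      ((hd r 2).mul (hd p 2))).neg.congr_deriv ?_
    simp only [hinner]
    ring
  have hy := vortexField_eq c φ (α t)
  generalize (fun i => φ (-coshSide (α t) i)) = y at hy ⊢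
  refine hasDerivAt_pi.mpr fun i => ?_
  fin_cases i
  · refine (hi 1 2).congr_deriv ?_
    simp [hy, hinner, hcross, interaction, tripleProduct]
    ring
  · refine (hi 0 2).congr_deriv ?_
    simp [hy, hinner, hcross, interaction, tripleProduct]
    ring
  · refine (hi 0 1).congr_deriv ?_
    simp [hy, hinner, hcross, interaction, tripleProduct]
    ring

lemma sum_interaction_div {c : Fin 3 → ℝ} (hc : ∀ i, c i ≠ 0) (y : Fin 3 → ℝ) :
    ∑ i, interaction c y i / c i = 0 := by
  have h0 := hc 0
  have h1 := hc 1
  have h2 := hc 2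
  simp [Fin.sum_univ_three, interaction]
  field_simp
  ring

lemma hasDerivAt_chetaev {n c y : Fin 3 → ℝ} {a k t : ℝ} {u : ℝ → Fin 3 → ℝ}
    (hu : HasDerivAt u (k • interaction c y) t) :
    HasDerivAt (fun s => chetaev n c fun i => u s i - a)
      (k * chetaevDeriv n c (fun i => u t i - a) y) t := by
  have h : ∀ i, HasDerivAt (fun s => u s i - a) (k * interaction c y i) t := fun i =>
    (hasDerivAt_pi.mp hu i).sub_const a
  have hI : ∀ i, HasDerivAt (fun s => interaction c (fun i => u s i - a) i)
      (k * interaction c (interaction c y) i) t := by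
    intro i
    fin_cases i
    · exact (((h 1).sub (h 2)).const_mul (c 0)).congr_deriv (by simp [interaction]; ring)
    · exact (((h 2).sub (h 0)).const_mul (c 1)).congr_deriv (by simp [interaction]; ring)
    · exact (((h 0).sub (h 1)).const_mul (c 2)).congr_deriv (by simp [interaction]; ring)
  refine (HasDerivAt.fun_sum fun i _ => ((h i).mul (hI i)).const_mul (n i)).congr_deriv ?_
  rw [chetaevDeriv, Finset.mul_sum]
  exact Finset.sum_congr rfl fun i _ => by ring

/-! ### Instability -/

/-- A continuous function `h` stays below `ε` if, on every interval around the initial time on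
which it is below `ε`, it is even at most `r < ε`. -/
lemma forall_lt_of_forall_subinterval {h : ℝ → ℝ} {r ε : ℝ} {S : Set ℝ} (hS : IsOpen S)
    (hSc : IsPreconnected S) (h0S : (0 : ℝ) ∈ S) (hh : ContinuousOn h S) (hrε : r < ε)
    (h0 : h 0 < ε)
    (hJ : ∀ J : Set ℝ, IsOpen J → J.OrdConnected → (0 : ℝ) ∈ J → J ⊆ S → (∀ t ∈ J, h t < ε) →
      ∀ t ∈ J, h t ≤ r) : ∀ t ∈ S, h t < ε := by
  set A := S ∩ h ⁻¹' Set.Iio ε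
  have hAo : IsOpen A := hh.isOpen_inter_preimage hS isOpen_Iio
  have h0A : (0 : ℝ) ∈ A := ⟨h0S, h0⟩
  -- The connected component of `0` in `A` is also closed relative to `S`.
  set J := connectedComponentIn A 0
  have hJA : J ⊆ A := connectedComponentIn_subset A 0
  have hJo : IsOpen J := hAo.connectedComponentIn
  have hJc : IsPreconnected J := isPreconnected_connectedComponentIn
  have h0J : (0 : ℝ) ∈ J := mem_connectedComponentIn h0A
  have hJr := hJ J hJo hJc.ordConnected h0J (fun t ht => (hJA ht).1) fun t ht => (hJA ht).2
  have hcl : closure J ∩ S ⊆ J := by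
    rintro t ⟨htJ, htS⟩
    have htr : h t ≤ r :=
      ContinuousWithinAt.closure_le htJ
        ((hh t htS).mono fun s hs => (hJA hs).1) continuousWithinAt_const hJr
    have htA : t ∈ A := ⟨htS, htr.trans_lt hrε⟩
    have hpre : IsPreconnected (insert t J) :=
      hJc.subset_closure (Set.subset_insert t J) (Set.insert_subset htJ subset_closure)
    exact hpre.subset_connectedComponentIn (Set.mem_insert_of_mem t h0J)
      (Set.insert_subset htA hJA) (Set.mem_insert t J)
  have hSJ : S ⊆ J := hSc.subset_of_closure_inter_subset hJo ⟨0, h0S, h0J⟩ hcl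
  exact fun t ht => (hJA (hSJ ht)).2

/-- Triangles that are close to an equilateral one are uniformly nondegenerate. -/
lemma eventually_le_tripleProduct_sq {a : ℝ} (ha : 1 < a) :
    ∃ D₀, 0 < D₀ ∧ ∀ᶠ ε in nhdsWithin (0 : ℝ) (Set.Ioi 0), ∀ x : Fin 3 → Fin 3 → ℝ,
      (∀ r, OnHyperboloid (x r)) → (∀ i, |coshSide x i - a| < ε) → D₀ ≤ |tripleProduct x| := by
  let P : (Fin 3 → ℝ) → ℝ := fun u =>
    1 + 2 * u 0 * u 1 * u 2 - u 0 ^ 2 - u 1 ^ 2 - u 2 ^ 2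
  have hP : Continuous P := by fun_prop
  have hPa : 0 < P fun _ => a := by
    have : P (fun _ => a) = (a - 1) ^ 2 * (2 * a + 1) := by simp only [P]; ring
    rw [this]
    have : 0 < a - 1 := sub_pos.mpr ha
    positivity
  obtain ⟨ε₀, hε₀, hball⟩ := Metric.eventually_nhds_iff.mp
    ((hP.tendsto fun _ => a).eventually (lt_mem_nhds (half_lt_self hPa)))
  refine ⟨√((P fun _ => a) / 2), Real.sqrt_pos.mpr (half_pos hPa), ?_⟩
  filter_upwards [Ioo_mem_nhdsGT hε₀] with ε hε x hx hu
  refine Real.sqrt_le_iff.mpr ⟨abs_nonneg _, ?_⟩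
  rw [sq_abs, tripleProduct_sq hx]
  refine (hball ((dist_pi_lt_iff hε₀).mpr fun i => ?_)).le
  rw [Real.dist_eq]
  exact (hu i).trans hε.2

/-- For suitable weights the Chetaev function does not vanish in the direction `(c₀, -c₁, 0)` in which
the third vortex can be moved. With unit weights it vanishes there if `c₀ = c₁`. -/
lemma exists_weights_chetaev_ne_zero {c : Fin 3 → ℝ} (hc : ∀ i, c i ≠ 0) :
    ∃ n : Fin 3 → ℝ, (∀ i, 1 ≤ n i) ∧ ∀ (s : ℝ) (δ : Fin 3 → ℝ), s ≠ 0 → δ 0 = s * c 0 →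
      δ 1 = s * -c 1 → δ 2 = 0 → chetaev n c δ ≠ 0 := by
  obtain ⟨w, hw, hne⟩ : ∃ w : ℝ, 1 ≤ w ∧ w * c 1 - c 0 ≠ 0 := by
    by_cases h : c 1 = c 0
    · refine ⟨2, one_le_two, ?_⟩
      rw [h, two_mul, add_sub_cancel_right]
      exact hc 0
    · exact ⟨1, le_rfl, by rwa [one_mul, sub_ne_zero]⟩
  refine ⟨![1, w, 1], fun i => by fin_cases i <;> simp [hw], fun s δ hs h0 h1 h2 => ?_⟩
  have : chetaev ![1, w, 1] c δ = s ^ 2 * c 0 * c 1 * (w * c 1 - c 0) := by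
    simp [chetaev, interaction, Fin.sum_univ_three, h0, h1, h2]
    ring
  rw [this]
  have := hc 0
  have := hc 1
  positivity

/-- Where the reduced equations have a saddle, no neighbourhood of an equilateral configuration
confines the trajectories. The group of symmetries is irrelevant: the neighbourhood of the
configuration that trajectories leave is invariant under the whole group, and the trajectories that
leave it start arbitrarily close to the configuration. -/
lemma not_isStable_of_vorticity_sum_neg {Γ : Fin 3 → ℝ} (hΓ : ∀ i, Γ i ≠ 0) {X : PhaseSpace 3}
    {a : ℝ} (ha : 1 < a) (hX : ∀ i, coshSide (position X) i = a)
    (hσ : Γ 0 * Γ 1 + Γ 1 * Γ 2 + Γ 2 * Γ 0 < 0) (H : Subgroup SL(2, ℝ)) :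
    ¬ IsStable Γ H X := by
  intro hstab
  set c : Fin 3 → ℝ := fun p => Γ p / Real.pi with hcdef
  have hc : ∀ i, c i ≠ 0 := fun i => div_ne_zero (hΓ i) Real.pi_ne_zero
  have hσc : c 0 * c 1 + c 1 * c 2 + c 2 * c 0 < 0 := by
    have : c 0 * c 1 + c 1 * c 2 + c 2 * c 0 =
        (Γ 0 * Γ 1 + Γ 1 * Γ 2 + Γ 2 * Γ 0) / Real.pi ^ 2 := by
      simp only [hcdef]; ring
    rw [this]
    exact div_neg_of_neg_of_pos hσ (by positivity)
  obtain ⟨n, hn, hne⟩ := exists_weights_chetaev_ne_zero hc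
  have hf : HasDerivAt (fun u : ℝ => (u ^ 2 - 1)⁻¹) (-(2 * a) / (a ^ 2 - 1) ^ 2) a := by
    have h1 : HasDerivAt (fun u : ℝ => u ^ 2 - 1) (2 * a) a := by
      simpa using (hasDerivAt_pow 2 a).sub_const 1
    exact h1.fun_inv (by nlinarith)
  have hm : -(2 * a) / (a ^ 2 - 1) ^ 2 < 0 := by
    have : 0 < a ^ 2 - 1 := by nlinarith
    exact div_neg_of_neg_of_pos (by linarith) (by positivity)
  obtain ⟨k, hk, hkev⟩ := exists_chetaevDeriv_le hn hc hσc hf hm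
  obtain ⟨D₀, hD₀, hDev⟩ := eventually_le_tripleProduct_sq ha
  obtain ⟨C, hC, hCle⟩ := abs_chetaev_le n c
  obtain ⟨ε, ⟨hεQ, hεD⟩, hε⟩ := ((hkev.and hDev).and
    (Ioo_mem_nhdsGT (show (0 : ℝ) < (a - 1) / 2 by linarith))).exists
  obtain ⟨hε0, hεa⟩ := hε
  obtain ⟨φ, hφs, hφ, K, hK, hφK⟩ := exists_regular_coupling hε0 (by linarith : 2 * ε < a - 1)
  -- the distance of the sides of a triangle from those of the equilateral one
  let dev : (Fin 3 → Fin 3 → ℝ) → ℝ := fun x => dist (coshSide x) fun _ => a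
  have hdevc : Continuous dev := continuous_coshSide.dist continuous_const
  have hdev_lt : ∀ x, dev x < ε → ∀ i, |coshSide x i - a| < ε := fun x hx i =>
    (dist_pi_lt_iff hε0).mp hx i
  have hdevX : dev (position X) = 0 := by
    simp only [dev, dist_eq_zero]
    exact funext hX
  obtain ⟨U, hUo, hXU, -, hU⟩ := hstab {Y | dev (position Y) < ε / 2}
    (isOpen_lt (hdevc.comp isInducing_position.continuous) continuous_const)
    (by simp only [Set.mem_ofPred_eq, hdevX]; positivity)
    (fun g _ Y hY => by
      simpa only [Set.mem_ofPred_eq, dev, coshSide_position_smul] using hY)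
  have hDX : tripleProduct (position X) ≠ 0 := by
    have := hεD (position X) (onHyperboloid_position X) (hdev_lt _ (by rw [hdevX]; exact hε0))
    exact abs_pos.mp (hD₀.trans_le this)
  -- a nearby configuration on the same level set of the conserved quantity `∑ uᵢ / Γᵢ`
  obtain ⟨Y, ⟨hYU, hYε⟩, s, hs, hY0, hY1, hY2⟩ :=
    exists_coshSide_perturbation ha hX hDX (c 0) (-c 1) (hc 0)
      (hUo.inter (isOpen_lt (hdevc.comp isInducing_position.continuous) continuous_const))
      ⟨hXU, show dev (position X) < ε by rw [hdevX]; exact hε0⟩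
  change dev (position Y) < ε at hYε
  set w := |chetaev n c fun i => coshSide (position Y) i - a| with hw
  have hw0 : 0 < w := abs_pos.mpr <|
    hne s _ hs (by simp [hY0]) (by simp [hY1]) (by simp [hY2])
  set κ := D₀ * k / C with hκ
  have hκ0 : 0 < κ := by positivity
  set B := C * (3 * ε ^ 2)
  -- the time after which the Chetaev function has left its range on the neighbourhood
  set T := (B + 1) / (κ * w) with hT
  have hT0 : 0 < T := by positivity
  obtain ⟨α, hα0, hα, hαH⟩ := exists_vortexField_solution c hφs hK hφK
    (onHyperboloid_position Y) (by linarith : 0 < T + 1)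
  set S := Set.Ioo (-(T + 1)) (T + 1)
  have h0S : (0 : ℝ) ∈ S := ⟨by linarith, by linarith⟩
  have hαc : ContinuousOn α S := fun t ht => (hα t ht).continuousAt.continuousWithinAt
  have hdev : ∀ t ∈ S, dev (α t) < ε := by
    refine forall_lt_of_forall_subinterval (r := ε / 2) isOpen_Ioo isPreconnected_Ioo h0S
      (hdevc.comp_continuousOn hαc) (by linarith) (by rwa [hα0]) ?_
    intro J hJo hJc h0J hJS hJε t ht
    obtain ⟨γ, hγ, hγα⟩ := exists_isTrajectory (by linarith : ε < a - 1) hφ X hJo hJc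
      (fun t ht => hα t (hJS ht)) (fun t ht => hαH t (hJS ht)) fun t ht => hdev_lt _ (hJε t ht)
    have hγ0 : γ 0 = Y := position_injective (by rw [hγα 0 h0J, hα0])
    have := hU J γ hγ ⟨0, h0J, by rwa [hγ0]⟩ t ht
    rw [Set.mem_ofPred_eq, hγα t ht] at this
    exact this.le
  let u : ℝ → Fin 3 → ℝ := fun t => coshSide (α t)
  have hu : ∀ t ∈ S, ∀ i, |u t i - a| < ε := fun t ht => hdev_lt _ (hdev t ht)
  have hud : ∀ t ∈ S, HasDerivAt u
      (tripleProduct (α t) • interaction c fun i => (u t i ^ 2 - 1)⁻¹) t := fun t ht => by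
    refine (hasDerivAt_coshSide (hα t ht)).congr_deriv ?_
    congr 2
    funext i
    rw [hφ, neg_sq]
    rw [neg_add_eq_sub, abs_sub_comm]
    exact (hu t ht i).le
  have hsum : ∀ t ∈ S, ∑ i, (u t i - a) / c i = 0 := by
    have hsd : ∀ t ∈ S, HasDerivAt (fun t => ∑ i, (u t i - a) / c i) 0 t := fun t ht => by
      refine (HasDerivAt.fun_sum fun i _ =>
        ((hasDerivAt_pi.mp (hud t ht) i).sub_const a).div_const (c i)).congr_deriv ?_
      simp only [Pi.smul_apply, smul_eq_mul, mul_div_assoc, ← Finset.mul_sum,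
        sum_interaction_div hc, mul_zero]
    intro t ht
    have h0 : ∑ i, (u 0 i - a) / c i = 0 := by
      have := hc 0
      have := hc 1
      simp only [u, hα0, Fin.sum_univ_three, hY0, hY1, hY2]
      field_simp
      ring
    rw [← h0]
    exact isOpen_Ioo.is_const_of_deriv_eq_zero isPreconnected_Ioo
      (fun t ht => (hsd t ht).differentiableAt.differentiableWithinAt)
      (fun t ht => (hsd t ht).deriv) ht h0S
  let g : ℝ → ℝ := fun t => chetaev n c fun i => u t i - a
  let Q : ℝ → ℝ := fun t => chetaevDeriv n c (fun i => u t i - a) fun i => (u t i ^ 2 - 1)⁻¹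
  have hgd : ∀ t ∈ S, HasDerivAt g (tripleProduct (α t) * Q t) t := fun t ht =>
    hasDerivAt_chetaev (hud t ht)
  have hgle : ∀ t ∈ S, |g t| ≤ B := fun t ht => by
    refine (hCle _).trans (mul_le_mul_of_nonneg_left ?_ hC.le)
    rw [Fin.sum_univ_three]
    have h : ∀ i, (u t i - a) ^ 2 ≤ ε ^ 2 := fun i => by
      rw [← sq_abs]
      exact pow_le_pow_left₀ (abs_nonneg _) (hu t ht i).le 2
    linarith [h 0, h 1, h 2]
  have hDge : ∀ t ∈ S, D₀ ≤ |tripleProduct (α t)| := fun t ht => hεD _ (hαH t ht) (hu t ht)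
  -- `|g'| ≥ κ |g|`, and `g'` has the sign opposite to that of the triple product
  have hgrow : ∀ t ∈ S, κ * |g t| ≤ |tripleProduct (α t)| * -Q t := fun t ht => by
    set N := ∑ i, (u t i - a) ^ 2
    have h1 : k * N ≤ -Q t := by
      have := hεQ (u t) (hu t ht) (hsum t ht)
      linarith
    have hN0 : 0 ≤ N := Finset.sum_nonneg fun i _ => sq_nonneg _
    calc κ * |g t| ≤ κ * (C * N) := mul_le_mul_of_nonneg_left (hCle _) hκ0.le
      _ = D₀ * (k * N) := by rw [hκ]; field_simp
      _ ≤ |tripleProduct (α t)| * (k * N) :=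
          mul_le_mul_of_nonneg_right (hDge t ht) (by positivity)
      _ ≤ _ := mul_le_mul_of_nonneg_left h1 (abs_nonneg _)
  have hDc : ContinuousOn (fun t => tripleProduct (α t)) S :=
    continuous_tripleProduct.comp_continuousOn hαc
  have hDne : ∀ t ∈ S, tripleProduct (α t) ≠ 0 := fun t ht =>
    abs_pos.mp (hD₀.trans_le (hDge t ht))
  have hsub : Set.Icc (-T) T ⊆ S := fun t ht => ⟨by linarith [ht.1], by linarith [ht.2]⟩
  have hg0 : |g 0| = w := by simp only [g, u, hα0, hw]
  obtain ⟨t, ht, hle⟩ : ∃ t ∈ Set.Icc (-T) T, κ * |g 0| * T ≤ |g t| := by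
    rcases (hDne 0 h0S).lt_or_gt with h0 | h0
    · have hneg := pos_of_isPreconnected isPreconnected_Ioo hDc.neg
        (fun t ht => neg_ne_zero.mpr (hDne t ht)) h0S (neg_pos.mpr h0)
      refine exists_le_abs_of_mul_abs_le_deriv hκ0.le hT0.le (fun t ht => hgd t (hsub ht))
        fun t ht => ?_
      have := hgrow t (hsub ht)
      rwa [abs_of_neg (neg_pos.mp (hneg t (hsub ht))), neg_mul_neg] at this
    · have hpos := pos_of_isPreconnected isPreconnected_Ioo hDc hDne h0S h0
      have := exists_le_abs_of_mul_abs_le_deriv (g := fun t => -g t) hκ0.le hT0.le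
        (fun t ht => (hgd t (hsub ht)).neg) fun t ht => ?_
      · simpa only [abs_neg] using this
      · have := hgrow t (hsub ht)
        rwa [abs_of_pos (hpos t (hsub ht)), mul_neg, ← abs_neg] at this
  have hfin : κ * |g 0| * T = B + 1 := by
    rw [hg0, hT]
    field_simp
  linarith [hgle t (hsub ht)]

end PointVortex

end

theorem mainTheorem10 (Γ : Fin 3 → ℝ) (hΓ : ∀ i, Γ i ≠ 0) (X : PointVortex.PhaseSpace 3)
    (hX : PointVortex.IsEquilateral X) (hre : PointVortex.IsRelativeEquilibrium Γ X)
    (hμ : PointVortex.IsHyperbolicMomentum (PointVortex.momentum Γ X) ∨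
      PointVortex.IsParabolicMomentum (PointVortex.momentum Γ X)) :
    ¬ PointVortex.IsStable Γ ⊤ X ∧
      ¬ PointVortex.IsStable Γ (PointVortex.isotropy (PointVortex.momentum Γ X)) X := by
  obtain ⟨a, ha, hXa⟩ := hX.exists_coshSide_eq
  have hσ := PointVortex.vorticity_sum_neg hΓ ha hXa hμ
  exact ⟨PointVortex.not_isStable_of_vorticity_sum_neg hΓ ha hXa hσ _,
    PointVortex.not_isStable_of_vorticity_sum_neg hΓ ha hXa hσ _⟩
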